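/- **Crystallographic arrangements.** Let $r\ge 1$ and $V=\mathbb R^r$. A *simplicial arrangement* in $V$ is a finite set $\mathcal A$ of linear hyperplanes such that every *chamber*, i.e. every connected component of $V\setminus\bigcup_{H\in\mathcal A}H$, is an open simplicial cone $\{\sum_i a_iv_i\mid a_i>0\}$ for some basis $v_1,\dots,v_r$ of $V$. Let $R\subseteq V^*$ be a finite set with $\mathcal A=\{\ker\alpha\mid\alpha\in R\}$ and $\mathbb R\alpha\cap R=\{\pm\alpha\}$ for all $\alpha\in R$. The *walls* of a chamber $K$ are the $H\in\mathcal A$ with $\dim(H\cap\overline K)=r-1$, and $B^K$ is the set of all $\alpha\in R$ such that $\ker\alpha$ is a wall of $K$ and $\alpha\ge 0$ on $K$; it is a basis of $V^*$. The pair $(\mathcal A,R)$ is a *crystallographic arrangement* of rank $r$ if $R\subseteq\sum_{\alpha\in B^K}\mathbb Z\alpha$ for every chamber $K$. Two crystallographic arrangements $(\mathcal A,R)$, $(\mathcal A',R')$ in $V$ are *equivalent* if $\psi(R)=R'$ for some $\psi\in\mathrm{Aut}(V^*)$; arrangements of different ranks are not equivalent. **Cartan schemes.** A *Cartan scheme*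 $\mathcal C=(I,A,(\rho_i)_{i\in I},(C^a)_{a\in A})$ consists of a non-empty finite set $I$, a non-empty set $A$, maps $\rho_i:A\to A$ with $\rho_i^2=\mathrm{id}$, and generalized Cartan matrices $C^a=(c^a_{ij})\in\mathbb Z^{I\times I}$ (that is, $c^a_{ii}=2$, $c^a_{ij}\le 0$ for $i\ne j$, and $c^a_{ij}=0\Rightarrow c^a_{ji}=0$) with $c^a_{ij}=c^{\rho_i(a)}_{ij}$. Let $(\alpha_i)_{i\in I}$ be the standard basis of $\mathbb Z^I$ and let $\sigma_i^a\in\mathrm{Aut}(\mathbb Z^I)$, $\sigma_i^a(\alpha_j)=\alpha_j-c^a_{ij}\alpha_i$. In the *Weyl groupoid* the objects are the elements of $A$, and $\mathrm{Hom}(a,b)$ is the set of all automorphisms of $\mathbb Z^I$ that are compositions of maps $\sigma_i^c$, each regarded as a morphism from $c$ to $\rho_i(c)$, leading from $a$ to $b$. The scheme is *connected* if $\mathrm{Hom}(a,b)\neq\emptyset$ for all $a,b$, and *simply connected* if $\mathrm{Hom}(a,a)=\{\mathrm{id}\}$ for all $a$. The *real roots* at $a$ are the elements $w(\alpha_j)$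 with $b\in A$, $w\in\mathrm{Hom}(b,a)$, $j\in I$. Subsets $R^a\subseteq\mathbb Z^I$ ($a\in A$) form a *root system of type $\mathcal C$* if for all $a\in A$, $i,j\in I$: (R1) $R^a=R^a_+\cup-R^a_+$ with $R^a_+=R^a\cap\mathbb N_0^I$; (R2) $R^a\cap\mathbb Z\alpha_i=\{\pm\alpha_i\}$; (R3) $\sigma_i^a(R^a)=R^{\rho_i(a)}$; (R4) if $i\ne j$ and $m=|R^a\cap(\mathbb N_0\alpha_i+\mathbb N_0\alpha_j)|$ is finite, then $(\rho_i\rho_j)^m(a)=a$. It is *finite* if all $R^a$ are finite. Cartan schemes $\mathcal C,\mathcal C'$ are *equivalent* if there are bijections $\varphi_0:I\to I'$, $\varphi_1:A\to A'$ with $\varphi_1(\rho_i(a))=\rho'_{\varphi_0(i)}(\varphi_1(a))$ and $c'^{\,\varphi_1(a)}_{\varphi_0(i)\varphi_0(j)}=c^a_{ij}$ for all $i,j,a$. **The scheme $\mathcal C(\mathcal A,R,K_0)$.** Let $(\mathcal A,R)$ be a crystallographic arrangement of rank $r$, $K_0$ a chamber, and $B^{K_0}=\{\alpha_1,\dots,\alpha_r\}$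 an ordering. For a chamber $K$ and $\alpha\in B^K$ there is a unique chamber $K'\ne K$ such that $\overline K\cap\overline{K'}$ spans $\ker\alpha$ (the chamber *adjacent* to $K$ along $\ker\alpha$), and there are unique $c_\beta\in\mathbb N_0$ ($\beta\in B^K\setminus\{\alpha\}$) such that $\alpha\mapsto-\alpha$, $\beta\mapsto\beta+c_\beta\alpha$ is a bijection $B^K\to B^{K'}$; extend it linearly to $V^*$. Starting with $K_0$, a finite (possibly empty) sequence $a=(\mu_1,\dots,\mu_m)$ in $I=\{1,\dots,r\}$ defines chambers $K_0,\dots,K_m$ and automorphisms $\pi_0=\mathrm{id},\dots,\pi_m=:\pi(a)$ of $V^*$: $K_k$ is adjacent to $K_{k-1}$ along $\ker\pi_{k-1}(\alpha_{\mu_k})$, and $\pi_k$ is $\pi_{k-1}$ followed by the linear extension of the bijection $B^{K_{k-1}}\to B^{K_k}$. Let $A$ be the set of classes of sequences under $a\sim b\Leftrightarrow\pi(a)=\pi(b)$, let $\rho_i$ map the class of $a$ to the class of the sequence $a.i$ ($a$ extended by $i$), and let $C^a=(c^a_{ij})$ be given by $\pi(a.i)(\alpha_j)=\pi(a)(\alpha_j)-c^a_{ij}\,\pi(a)(\alpha_i)$.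 Then $\mathcal C(\mathcal A,R,K_0)=(I,A,(\rho_i),(C^a))$. **Theorem.** Let $\mathfrak A$ be the class of all crystallographic arrangements (of all ranks $r\geq 1$), and let $\mathfrak C$ be the class of all connected simply connected Cartan schemes for which the real roots form a finite root system. Every crystallographic arrangement has a chamber, each $B^K$ is a basis of $V^*$, the scheme $\mathcal C(\mathcal A,R,K)$ lies in $\mathfrak C$ for every chamber $K$ and every ordering of $B^K$, its equivalence class depends only on the equivalence class of $(\mathcal A,R)$, and the map $$\Lambda:\mathfrak A/_{\cong}\to\mathfrak C/_{\cong},\qquad \overline{(\mathcal A,R)}\mapsto\overline{\mathcal C(\mathcal A,R,K)}\quad(K\text{ any chamber})$$ is a bijection. Moreover, $R$ is the set of real roots: for each object of $\mathcal C(\mathcal A,R,K)$, represented by a sequence $a$, the map $\mathbb Z^r\to V^*$, $x\mapsto\sum_jx_j\,\pi(a)(\alpha_j)$ maps the real roots at this object onto $R$. -/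

import Mathlib

open Module

universe u v u' v'

noncomputable section

/-! ### Simplicial and crystallographic arrangements in `ℝ ^ r` -/

namespace Arrangement

variable {r : ℕ}

/-- The complement of the union of the hyperplanes. -/
def complement (𝒜 : Set (Submodule ℝ (Fin r → ℝ))) : Set (Fin r → ℝ) :=
  {v | ∀ H ∈ 𝒜, v ∉ H}

/-- The chambers: the connected components of the complement. -/
def chambers (𝒜 : Set (Submodule ℝ (Fin r → ℝ))) : Set (Set (Fin r → ℝ)) :=
  {K | ∃ v ∈ complement 𝒜, K = connectedComponentIn (complement 𝒜) v}

/-- Open simplicial cones: all positive linear combinations of a basis. -/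
def IsOpenSimplicialCone (K : Set (Fin r → ℝ)) : Prop :=
  ∃ b : Basis (Fin r) ℝ (Fin r → ℝ),
    K = {v | ∃ a : Fin r → ℝ, (∀ i, 0 < a i) ∧ v = ∑ i, a i • b i}

/-- A simplicial arrangement: finitely many linear hyperplanes all of whose chambers are open
simplicial cones. -/
structure IsSimplicial (𝒜 : Set (Submodule ℝ (Fin r → ℝ))) : Prop where
  finite : 𝒜.Finite
  hyperplane : ∀ H ∈ 𝒜, finrank ℝ H + 1 = r
  cone : ∀ K ∈ chambers 𝒜, IsOpenSimplicialCone K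

/-- The walls of `K`: the hyperplanes `H` with `dim (H ∩ closure K) = r - 1`. (For a chamber `K`,
the set `H ∩ closure K` is a convex cone containing `0`, so that its dimension is the dimension of
its linear span.) -/
def walls (𝒜 : Set (Submodule ℝ (Fin r → ℝ))) (K : Set (Fin r → ℝ)) :
    Set (Submodule ℝ (Fin r → ℝ)) :=
  {H | H ∈ 𝒜 ∧ finrank ℝ (Submodule.span ℝ ((H : Set (Fin r → ℝ)) ∩ closure K)) + 1 = r}

/-- The set `B^K` of the elements of `R` that are normal to the walls of `K` and point to the
inside. -/
def base (𝒜 : Set (Submodule ℝ (Fin r → ℝ))) (R : Set (Dual ℝ (Fin r → ℝ)))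
    (K : Set (Fin r → ℝ)) : Set (Dual ℝ (Fin r → ℝ)) :=
  {α | α ∈ R ∧ LinearMap.ker α ∈ walls 𝒜 K ∧ ∀ v ∈ K, 0 ≤ α v}

/-- Two chambers are adjacent along the hyperplane `H` if they are distinct and have a common facet
spanning `H`. -/
def Adjacent (𝒜 : Set (Submodule ℝ (Fin r → ℝ))) (H : Submodule ℝ (Fin r → ℝ))
    (K K' : Set (Fin r → ℝ)) : Prop :=
  K ∈ chambers 𝒜 ∧ K' ∈ chambers 𝒜 ∧ K ≠ K' ∧ Submodule.span ℝ (closure K ∩ closure K') = H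

end Arrangement

/-- Crystallographic arrangements `(𝒜, R)`, of arbitrary rank `r ≥ 1`. -/
structure CrystallographicArrangement where
  /-- the dimension of the ambient space -/
  r : ℕ
  r_pos : 0 < r
  /-- the hyperplanes -/
  𝒜 : Set (Submodule ℝ (Fin r → ℝ))
  /-- the normal vectors -/
  R : Set (Dual ℝ (Fin r → ℝ))
  simplicial : Arrangement.IsSimplicial 𝒜
  finite_R : R.Finite
  𝒜_eq : 𝒜 = {H | ∃ α ∈ R, H = LinearMap.ker α}
  reduced : ∀ α ∈ R, {β | β ∈ R ∧ ∃ t : ℝ, β = t • α} = {α, -α}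
  integral : ∀ K ∈ Arrangement.chambers 𝒜,
    R ⊆ (Submodule.span ℤ (Arrangement.base 𝒜 R K) : Set (Dual ℝ (Fin r → ℝ)))

namespace CrystallographicArrangement

/-- `(𝒜, R) ≅ (𝒜', R')`: some linear isomorphism of the dual spaces maps `R` onto `R'`. (It forces
the ranks to be equal.) -/
def Equivalent (X Y : CrystallographicArrangement) : Prop :=
  ∃ ψ : Dual ℝ (Fin X.r → ℝ) ≃ₗ[ℝ] Dual ℝ (Fin Y.r → ℝ), ψ '' X.R = Y.R

instance setoid : Setoid CrystallographicArrangement where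
  r := Equivalent
  iseqv :=
    { refl := fun X => ⟨LinearEquiv.refl ℝ _, Set.image_id _⟩
      symm := by
        rintro X Y ⟨ψ, h⟩
        refine ⟨ψ.symm, ?_⟩
        rw [← h, ← Set.image_comp]
        simp
      trans := by
        rintro X Y Z ⟨ψ, h⟩ ⟨χ, h'⟩
        refine ⟨ψ.trans χ, ?_⟩
        rw [← h', ← h, ← Set.image_comp]
        rfl }

end CrystallographicArrangement

/-! ### Cartan schemes, Weyl groupoids and real roots -/

set_option linter.checkUnivs false

/-- A quadruple `(I, A, (ρ_i), (C^a))` consisting of a finite set, a set, self-maps of `A` and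
integral matrices. -/
structure CartanQuadruple where
  /-- the labels -/
  I : Type u
  /-- the objects -/
  A : Type v
  [fintypeI : Fintype I]
  [decEqI : DecidableEq I]
  /-- the maps between the objects -/
  ρ : I → A → A
  /-- the matrices -/
  C : A → Matrix I I ℤ

namespace CartanQuadruple

attribute [instance] fintypeI decEqI

/-- Generalized Cartan matrices. -/
structure IsGeneralizedCartanMatrix {I : Type u} (C : Matrix I I ℤ) : Prop where
  diag : ∀ i, C i i = 2
  nonpos : ∀ j k, j ≠ k → C j k ≤ 0
  zero : ∀ i j, C i j = 0 → C j i = 0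

/-- Cartan schemes. -/
structure IsCartanScheme (S : CartanQuadruple.{u, v}) : Prop where
  nonempty_I : Nonempty S.I
  nonempty_A : Nonempty S.A
  cartan : ∀ a, IsGeneralizedCartanMatrix (S.C a)
  ρ_ρ : ∀ i a, S.ρ i (S.ρ i a) = a
  C_ρ : ∀ i j a, S.C a i j = S.C (S.ρ i a) i j

/-- The standard basis `α_i` of `ℤ ^ I`. -/
def simpleRoot (S : CartanQuadruple.{u, v}) (i : S.I) : S.I → ℤ := Pi.single i 1

/-- The map `σ_i^a` of `ℤ ^ I` with `σ_i^a (α_j) = α_j - c_{ij}^a α_i`. -/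
def s (S : CartanQuadruple.{u, v}) (a : S.A) (i : S.I) : (S.I → ℤ) →ₗ[ℤ] (S.I → ℤ) :=
  (Pi.basisFun ℤ S.I).constr ℤ fun j => S.simpleRoot j - S.C a i j • S.simpleRoot i

/-- `S.IsMorphism a b w`: `w ∈ Hom (a, b)` in the Weyl groupoid, that is, `w` is a composition
of maps `σ_i^c`, each regarded as a morphism from `c` to `ρ_i c`, leading from `a` to `b`. -/
inductive IsMorphism (S : CartanQuadruple.{u, v}) (a : S.A) :
    S.A → ((S.I → ℤ) →ₗ[ℤ] (S.I → ℤ)) → Prop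
  | id : IsMorphism S a a LinearMap.id
  | comp (b : S.A) (w : (S.I → ℤ) →ₗ[ℤ] (S.I → ℤ)) (i : S.I) (h : IsMorphism S a b w) :
      IsMorphism S a (S.ρ i b) (S.s b i ∘ₗ w)

/-- The Weyl groupoid is connected. -/
def IsConnected (S : CartanQuadruple.{u, v}) : Prop :=
  ∀ a b, ∃ w, S.IsMorphism a b w

/-- `Hom (a, a) = {id_a}` for every object `a`. -/
def IsSimplyConnected (S : CartanQuadruple.{u, v}) : Prop :=
  ∀ a w, S.IsMorphism a a w → w = LinearMap.id

/-- The real roots at `a`. -/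
def realRoots (S : CartanQuadruple.{u, v}) (a : S.A) : Set (S.I → ℤ) :=
  {x | ∃ b w j, S.IsMorphism b a w ∧ x = w (S.simpleRoot j)}

/-- Root systems of type `S`. -/
structure IsRootSystem (S : CartanQuadruple.{u, v}) (R : S.A → Set (S.I → ℤ)) : Prop where
  R1 : ∀ a, R a = {x | x ∈ R a ∧ ∀ k, 0 ≤ x k} ∪ {x | -x ∈ R a ∧ ∀ k, 0 ≤ (-x) k}
  R2 : ∀ a i, {x | x ∈ R a ∧ ∃ t : ℤ, x = t • S.simpleRoot i} =
    {S.simpleRoot i, -S.simpleRoot i}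
  R3 : ∀ a i, S.s a i '' R a = R (S.ρ i a)
  R4 : ∀ a i j, i ≠ j →
    {x | x ∈ R a ∧ ∃ p q : ℕ, x = p • S.simpleRoot i + q • S.simpleRoot j}.Finite →
    (S.ρ i ∘ S.ρ j)^[{x | x ∈ R a ∧
      ∃ p q : ℕ, x = p • S.simpleRoot i + q • S.simpleRoot j}.ncard] a = a

/-- Connected simply connected Cartan schemes for which the real roots form a finite root
system. -/
structure IsFiniteType (S : CartanQuadruple.{u, v}) : Prop where
  scheme : S.IsCartanScheme
  connected : S.IsConnected
  simplyConnected : S.IsSimplyConnected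
  rootSystem : S.IsRootSystem S.realRoots
  finite : ∀ a, (S.realRoots a).Finite

/-- Equivalence of Cartan schemes. -/
def Equivalent (S : CartanQuadruple.{u, v}) (T : CartanQuadruple.{u', v'}) : Prop :=
  ∃ (φ₀ : S.I ≃ T.I) (φ₁ : S.A ≃ T.A),
    (∀ i a, φ₁ (S.ρ i a) = T.ρ (φ₀ i) (φ₁ a)) ∧
    ∀ i j a, T.C (φ₁ a) (φ₀ i) (φ₀ j) = S.C a i j

end CartanQuadruple

/-- The class of all connected simply connected Cartan schemes for which the real roots form a
finite root system. -/
def FiniteTypeScheme : Type (max (u + 1) (v + 1)) :=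
  {S : CartanQuadruple.{u, v} // S.IsFiniteType}

instance FiniteTypeScheme.setoid : Setoid FiniteTypeScheme.{u, v} where
  r S T := S.1.Equivalent T.1
  iseqv :=
    { refl := fun S => ⟨Equiv.refl _, Equiv.refl _, fun _ _ => rfl, fun _ _ _ => rfl⟩
      symm := by
        rintro S T ⟨f, g, h, h'⟩
        refine ⟨f.symm, g.symm, fun i a => ?_, fun i j a => ?_⟩
        · rw [Equiv.symm_apply_eq, h]; simp
        · rw [← h']; simp
      trans := by
        rintro S T U ⟨f, g, h, h'⟩ ⟨f₂, g₂, k, k'⟩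
        refine ⟨f.trans f₂, g.trans g₂, fun i a => ?_, fun i j a => ?_⟩
        · simp [h, k]
        · simp [h', k'] }

/-! ### The Cartan scheme of a crystallographic arrangement -/

/-- For a basis `b` and natural numbers `c`, the linear involution
`b i ↦ - b i`, `b j ↦ b j + c j • b i` for `j ≠ i`. -/
def basisReflection {r : ℕ} {W : Type*} [AddCommGroup W] [Module ℝ W]
    (b : Basis (Fin r) ℝ W) (i : Fin r) (c : Fin r → ℕ) : W ≃ₗ[ℝ] W :=
  have h : (b.constr ℝ fun j => if j = i then -b i else b j + c j • b i) ∘ₗ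
      (b.constr ℝ fun j => if j = i then -b i else b j + c j • b i) = LinearMap.id := by
    refine b.ext fun j => ?_
    rw [LinearMap.comp_apply, Basis.constr_basis]
    by_cases hj : j = i
    · rw [if_pos hj, map_neg, Basis.constr_basis, if_pos rfl, neg_neg, hj, LinearMap.id_apply]
    · rw [if_neg hj, map_add, map_nsmul, Basis.constr_basis, Basis.constr_basis, if_pos rfl,
        if_neg hj, LinearMap.id_apply, smul_neg, add_neg_cancel_right]
  LinearEquiv.ofLinearMap _ _ h h

namespace CrystallographicArrangement

variable (X : CrystallographicArrangement)

/-- An ordering `B^K = {α_1, …, α_r}` of the basis attached to the chamber `K`. -/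
def IsOrdering (K : Set (Fin X.r → ℝ)) (α : Basis (Fin X.r) ℝ (Dual ℝ (Fin X.r → ℝ))) : Prop :=
  Set.range α = Arrangement.base X.𝒜 X.R K

/-- The unique chamber adjacent to the chamber `K` along its wall `H`. -/
def nextChamber (K : Set (Fin X.r → ℝ)) (H : Submodule ℝ (Fin X.r → ℝ)) : Set (Fin X.r → ℝ) :=
  Classical.epsilon fun K' => Arrangement.Adjacent X.𝒜 H K K'

/-- For an ordering `b` of `B^K` and the chamber `K'` adjacent to `K` along the kernel of `b i`, the
natural numbers `c j` (unique for `j ≠ i`) such that `b i ↦ - b i`,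
`b j ↦ b j + c j • b i` is a bijection from `B^K` to `B^K'`. -/
def coeff (K : Set (Fin X.r → ℝ)) (b : Basis (Fin X.r) ℝ (Dual ℝ (Fin X.r → ℝ)))
    (i : Fin X.r) : Fin X.r → ℕ :=
  Classical.epsilon fun c => Set.BijOn (basisReflection b i c) (Set.range b)
    (Arrangement.base X.𝒜 X.R (X.nextChamber K (LinearMap.ker (b i))))

/-- One step of the construction. A state is a chamber `K`, with an automorphism `π` of `V*` that
maps the fixed basis `α` of the starting chamber to an ordering of `B^K`; the step
in direction `i` passes to the chamber adjacent to `K` along the kernel of `π (α_i)`, and composes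
`π` with the reflection `σ_i^K`. -/
def step (α : Basis (Fin X.r) ℝ (Dual ℝ (Fin X.r → ℝ)))
    (x : Set (Fin X.r → ℝ) × (Dual ℝ (Fin X.r → ℝ) ≃ₗ[ℝ] Dual ℝ (Fin X.r → ℝ))) (i : Fin X.r) :
    Set (Fin X.r → ℝ) × (Dual ℝ (Fin X.r → ℝ) ≃ₗ[ℝ] Dual ℝ (Fin X.r → ℝ)) :=
  (X.nextChamber x.1 (LinearMap.ker (x.2 (α i))),
    x.2.trans (basisReflection (α.map x.2) i (X.coeff x.1 (α.map x.2) i)))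

/-- The chamber `K_a` reached from `K₀` along the sequence `a = (μ_1, …, μ_m)`, and the
automorphism `π(a) = σ_{μ_m} ⋯ σ_{μ_1}` of `V*`. -/
def walk (K₀ : Set (Fin X.r → ℝ)) (α : Basis (Fin X.r) ℝ (Dual ℝ (Fin X.r → ℝ)))
    (a : List (Fin X.r)) :
    Set (Fin X.r → ℝ) × (Dual ℝ (Fin X.r → ℝ) ≃ₗ[ℝ] Dual ℝ (Fin X.r → ℝ)) :=
  a.foldl (X.step α) (K₀, LinearEquiv.refl ℝ _)

/-- Sequences `a`, `b` are identified if `π(a) = π(b)`. -/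
def pathSetoid (K₀ : Set (Fin X.r → ℝ)) (α : Basis (Fin X.r) ℝ (Dual ℝ (Fin X.r → ℝ))) :
    Setoid (List (Fin X.r)) :=
  Setoid.ker fun a => (X.walk K₀ α a).2

/-- The ordered basis `φ_a(α_1), …, φ_a(α_r)` of the chamber `K_a`. -/
def pathBasis (K₀ : Set (Fin X.r → ℝ)) (α : Basis (Fin X.r) ℝ (Dual ℝ (Fin X.r → ℝ)))
    (a : List (Fin X.r)) : Basis (Fin X.r) ℝ (Dual ℝ (Fin X.r → ℝ)) :=
  α.map (X.walk K₀ α a).2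

/-- The integers `c_{ij}` with `φ_{a.i}(α_j) = φ_a(α_j) - c_{ij} φ_a(α_i)`. -/
def pathMatrix (K₀ : Set (Fin X.r → ℝ)) (α : Basis (Fin X.r) ℝ (Dual ℝ (Fin X.r → ℝ)))
    (a : List (Fin X.r)) : Matrix (Fin X.r) (Fin X.r) ℤ :=
  fun i j => if j = i then 2 else -(X.coeff (X.walk K₀ α a).1 (X.pathBasis K₀ α a) i j : ℤ)

/-- The Cartan scheme `C(𝒜, R, K₀)`, for an ordering `α` of `B^{K₀}`. The objects are the classes of
sequences, `ρ_i` maps the class of `a` to the class of `a.i`, and the matrix at the class of `a`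
is `pathMatrix` at `a`; both are independent of the representative `a`. -/
def cartanScheme (K₀ : Set (Fin X.r → ℝ)) (α : Basis (Fin X.r) ℝ (Dual ℝ (Fin X.r → ℝ))) :
    CartanQuadruple.{0, 0} where
  I := Fin X.r
  A := Quotient (X.pathSetoid K₀ α)
  ρ i a := Quotient.mk _ (a.out ++ [i])
  C a := X.pathMatrix K₀ α a.out

end CrystallographicArrangement

end

/-! The bridge between both sides is the root basis: a basis contained in `R` in which every member
of `R` has integral coordinates of one sign. The chambers of a crystallographic arrangement are the
cones on which the members of a root basis are positive. Crossing a wall replaces `b` by the only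
root basis with `b i ↦ -b i`, `b j ↦ b j + c_j b i`. A realization (`Realizes`) of a scheme attaches
root bases of a fixed `R` to its objects so that `ρ_i` acts by such steps, with the Cartan entries
as coefficients.

From arrangements to schemes: the realization `objectBasis` is injective, because sequences are
identified exactly when they yield the same ordered basis. Connectedness and an injective
realization imply finite type (`Realizes.isFiniteType`): morphisms are changes of coordinates, so
the real roots at an object are the coordinate vectors of `R`, and (R4) is the rank two relation
`full_eq`.

From schemes to arrangements: simple connectedness lets the reflections fit together to a
realization (`exists_realizes`). Every point off the hyperplanes lies in the cone of some object
(`exists_pos`), so the kernels of the roots form a crystallographic arrangement. The delicate point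
is that different objects have different bases (`Realizes.injective`). This is where (R4) enters,
through a Coxeter-type induction on the number of roots separating two objects.

Finally, injective realizations in isomorphic sets of roots come from equivalent schemes
(`Realizes.equivalent`), and equivalent schemes have isomorphic sets of roots
(`Realizes.exists_linearEquiv`). This gives well-definedness, injectivity and surjectivity of `Λ`.
-/

noncomputable section

/-! ### Root bases of finite reduced sets of vectors -/

namespace RootBasis

variable {W : Type*} [AddCommGroup W] [Module ℝ W] {ι κ : Type*}

/-- A finite symmetric set of vectors that contains only `± x` from every line `ℝ x`. -/
structure IsReducedSet (R : Set W) : Prop where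
  finite : R.Finite
  neg_mem : ∀ x ∈ R, -x ∈ R
  reduced : ∀ x ∈ R, ∀ t : ℝ, t • x ∈ R → t = 1 ∨ t = -1

/-- All coordinates of `x` are nonnegative. -/
def IsPos (b : Basis ι ℝ W) (x : W) : Prop := ∀ i, 0 ≤ b.repr x i

/-- A basis consisting of elements of `R` such that the coordinates of all elements of `R` are
integers of the same sign. -/
structure IsRootBasis (R : Set W) (b : Basis ι ℝ W) : Prop where
  mem : ∀ i, b i ∈ R
  integral : ∀ x ∈ R, ∀ i, ∃ n : ℤ, b.repr x i = n
  pos_or_neg : ∀ x ∈ R, IsPos b x ∨ IsPos b (-x)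

/-- The basis `b'` arises from `b` by `b i ↦ - b i` and `b j ↦ b j + c • b i` for `j ≠ i`. -/
def IsStep (b : Basis ι ℝ W) (i : ι) (b' : Basis ι ℝ W) : Prop :=
  b' i = -b i ∧ ∀ j, j ≠ i → ∃ c : ℝ, b' j = b j + c • b i

section

variable {R : Set W} {b b' : Basis ι ℝ W} {i : ι}

theorem IsReducedSet.ne_zero (hR : IsReducedSet R) {x : W} (hx : x ∈ R) : x ≠ 0 := by
  rintro rfl
  have := hR.reduced 0 hx 2 (by simpa using hx)
  norm_num at this

theorem isPos_basis (b : Basis ι ℝ W) (i : ι) : IsPos b (b i) := by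
  classical
  intro j
  rw [Basis.repr_self, Finsupp.single_apply]
  split_ifs <;> norm_num

theorem not_isPos_neg_basis (b : Basis ι ℝ W) (i : ι) : ¬IsPos b (-b i) := by
  intro h
  have := h i
  simp at this
  linarith

theorem not_isPos_neg {x : W} (hx : x ≠ 0) (h : IsPos b x) : ¬IsPos b (-x) := by
  intro h'
  refine hx (b.repr.injective (Finsupp.ext fun i => le_antisymm ?_ ?_))
  · simpa using h' i
  · simpa using h i

theorem IsRootBasis.isPos_neg_iff (hR : IsReducedSet R) (hb : IsRootBasis R b) {x : W}
    (hx : x ∈ R) : IsPos b (-x) ↔ ¬IsPos b x :=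
  ⟨fun h h' => not_isPos_neg (hR.ne_zero hx) h' h, fun h => (hb.pos_or_neg x hx).resolve_left h⟩

theorem isPos_sum [Fintype κ] {n : κ → ℝ} (hn : ∀ k, 0 ≤ n k) {y : κ → W}
    (hy : ∀ k, IsPos b (y k)) : IsPos b (∑ k, n k • y k) := by
  intro i
  simp only [map_sum, map_smul, Finsupp.coe_finsetSum, Finset.sum_apply, Finsupp.smul_apply]
  exact Finset.sum_nonneg fun k _ => mul_nonneg (hn k) (hy k i)

theorem isPos_of_isPos [Fintype κ] {b' : Basis κ ℝ W} (h : ∀ k, IsPos b (b' k)) {x : W}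
    (hx : IsPos b' x) : IsPos b x := by
  rw [← b'.sum_repr x]
  exact isPos_sum hx h

/-- Only the basis vectors occurring in `x` matter; for a root in the plane of `i` and `j` it is
enough to know the signs of two of them. -/
theorem isPos_neg_of_support [Fintype κ] {b' : Basis κ ℝ W} {x : W} (hx : IsPos b' x)
    (h : ∀ k, b'.repr x k ≠ 0 → IsPos b (-b' k)) : IsPos b (-x) := by
  classical
  have hs : -x = ∑ k, b'.repr x k • if b'.repr x k = 0 then 0 else -b' k := by
    conv_lhs => rw [← b'.sum_repr x]
    rw [← Finset.sum_neg_distrib]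
    refine Finset.sum_congr rfl fun k _ => ?_
    split_ifs with hk
    · rw [hk, zero_smul, zero_smul, neg_zero]
    · rw [smul_neg]
  rw [hs]
  refine isPos_sum hx fun k => ?_
  split_ifs with hk
  · intro; simp
  · exact h k hk

/-- If an element of `R` other than `b i` is nonnegative, then it has a positive coordinate outside
`i`. -/
theorem exists_repr_pos [Fintype ι] (hR : IsReducedSet R) {x : W} (hb : b i ∈ R) (hx : x ∈ R)
    (hpos : IsPos b x) (hne : x ≠ b i) : ∃ j, j ≠ i ∧ 0 < b.repr x j := by
  by_contra! H
  have h0 : ∀ j, j ≠ i → b.repr x j = 0 := fun j hj => le_antisymm (H j hj) (hpos j)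
  have hxi : x = b.repr x i • b i := by
    conv_lhs => rw [← b.sum_repr x]
    exact Finset.sum_eq_single i (fun j _ hj => by rw [h0 j hj, zero_smul]) (by simp)
  rcases hR.reduced _ hb (b.repr x i) (hxi ▸ hx) with h | h
  · exact hne (by rw [hxi, h, one_smul])
  · have := hpos i
    linarith

/-- A step changes basis vectors only by multiples of `b i`, up to the sign of `b i` itself, so the
coordinate functionals outside `i` survive. -/
theorem IsStep.repr_eq (h : IsStep b i b') {j : ι} (hj : j ≠ i) (x : W) :
    b'.repr x j = b.repr x j := by
  classical
  have : b'.coord j = b.coord j := by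
    refine b'.ext fun k => ?_
    simp only [Basis.coord_apply, Basis.repr_self]
    by_cases hk : k = i
    · subst hk
      rw [h.1]
      simp [hj.symm]
    · obtain ⟨c, hc⟩ := h.2 k hk
      rw [hc]
      simp [Finsupp.single_apply, hj.symm]
  exact congrArg (fun f => f x) this

/-- The analogue of the fact that a simple reflection permutes the positive roots other than the
simple one. A positive root different from `b i` has a positive coordinate outside `i`; the step
preserves this coordinate, and all coordinates have the same sign. -/
theorem IsStep.isPos_iff [Fintype ι] (hR : IsReducedSet R) (hb : IsRootBasis R b)
    (hb' : IsRootBasis R b') (h : IsStep b i b') {x : W} (hx : x ∈ R) (h₁ : x ≠ b i)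
    (h₂ : x ≠ -b i) : IsPos b' x ↔ IsPos b x := by
  have key : ∀ y ∈ R, y ≠ b i → IsPos b y → IsPos b' y := by
    intro y hy hne hpos
    obtain ⟨j, hj, hlt⟩ := exists_repr_pos hR (hb.mem i) hy hpos hne
    refine (hb'.pos_or_neg y hy).resolve_right fun hneg => ?_
    have := hneg j
    rw [h.repr_eq hj] at this
    simp at this
    linarith
  refine ⟨fun hp => ?_, key x hx h₁⟩
  by_contra hn
  rw [← hb.isPos_neg_iff hR hx] at hn
  exact (hb'.isPos_neg_iff hR hx).1
    (key _ (hR.neg_mem x hx) (fun h => h₂ (by rw [← h, neg_neg])) hn) hp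

theorem IsStep.not_isPos (h : IsStep b i b') : ¬IsPos b' (b i) := by
  have := not_isPos_neg_basis b' i
  rwa [h.1, neg_neg] at this

/-- The coefficients of a step between root bases are determined. -/
theorem IsStep.unique [Fintype ι] {b'' : Basis ι ℝ W} (hb' : IsRootBasis R b')
    (hb'' : IsRootBasis R b'') (h : IsStep b i b') (h' : IsStep b i b'') : b' = b'' := by
  classical
  refine Basis.eq_of_apply_eq fun j => ?_
  by_cases hj : j = i
  · rw [hj, h.1, h'.1]
  obtain ⟨c, hc⟩ := h.2 j hj
  obtain ⟨d, hd⟩ := h'.2 j hj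
  -- With respect to `p`, the root `q j` has coordinate `1` at `j` and `s - t` at `i`, so `s - t` is
  -- nonnegative; by symmetry the coefficients agree.
  have aux : ∀ (p q : Basis ι ℝ W) (s t : ℝ), IsRootBasis R p → IsRootBasis R q → p i = -b i →
      p j = b j + s • b i → q j = b j + t • b i → t ≤ s := by
    intro p q s t hp hq hpi hpj hqj
    have e : q j = p j + (s - t) • p i := by
      rw [hqj, hpj, hpi]; module
    have hpos : IsPos p (q j) := by
      refine (hp.pos_or_neg _ (hq.mem j)).resolve_right fun hn => ?_
      have := hn j
      rw [e] at this
      simp [Ne.symm hj] at this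
      linarith
    have := hpos i
    rw [e] at this
    simp [hj] at this
    exact this
  have e : c = d := le_antisymm (aux b'' b' d c hb'' hb' h'.1 hd hc)
    (aux b' b'' c d hb' hb'' h.1 hc hd)
  rw [hc, hd, e]

theorem IsRootBasis.map {W' : Type*} [AddCommGroup W'] [Module ℝ W'] (hb : IsRootBasis R b)
    (ψ : W ≃ₗ[ℝ] W') : IsRootBasis (ψ '' R) (b.map ψ) where
  mem i := ⟨b i, hb.mem i, by simp⟩
  integral := by
    rintro _ ⟨x, hx, rfl⟩ i
    simpa using hb.integral x hx i
  pos_or_neg := by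
    rintro _ ⟨x, hx, rfl⟩
    simpa [IsPos] using hb.pos_or_neg x hx

theorem IsRootBasis.reindex (hb : IsRootBasis R b) (e : ι ≃ κ) : IsRootBasis R (b.reindex e) where
  mem k := by simpa using hb.mem _
  integral x hx k := by simpa using hb.integral x hx (e.symm k)
  pos_or_neg x hx := by
    rcases hb.pos_or_neg x hx with h | h
    · exact Or.inl fun k => by simpa using h (e.symm k)
    · exact Or.inr fun k => by simpa using h (e.symm k)

end

/-! ### Bases with the same nonnegative roots -/

section

variable {R : Set W} {b : Basis ι ℝ W} {b' : Basis κ ℝ W}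

theorem IsRootBasis.one_le_repr (hb : IsRootBasis R b) {x : W} (hx : x ∈ R) (hpos : IsPos b x)
    {i : ι} (h : b.repr x i ≠ 0) : 1 ≤ b.repr x i := by
  obtain ⟨n, hn⟩ := hb.integral x hx i
  have h₁ := hpos i
  rw [hn] at h h₁ ⊢
  norm_cast at h h₁ ⊢
  omega

variable [Fintype ι] [Fintype κ]

/-- An indecomposability argument: `1 = f x` is a sum of products whose factors are `0` or at least
`1`, so a single product survives and both its factors are `1`. -/
theorem IsRootBasis.exists_repr_eq_one (hb : IsRootBasis R b') (f : W →ₗ[ℝ] ℝ) {x : W}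
    (hx : x ∈ R) (hpos : IsPos b' x) (hfx : f x = 1)
    (hf : ∀ k, f (b' k) = 0 ∨ 1 ≤ f (b' k)) :
    ∃ k, b'.repr x k = 1 ∧ f (b' k) = 1 ∧ ∀ l, l ≠ k → f (b' l) ≠ 0 → b'.repr x l = 0 := by
  classical
  have hs : ∑ k, b'.repr x k * f (b' k) = 1 := by
    rw [← hfx]
    conv_rhs => rw [← b'.sum_repr x, map_sum]
    simp
  have hnn : ∀ k, 0 ≤ b'.repr x k * f (b' k) := fun k =>
    mul_nonneg (hpos k) (by rcases hf k with h | h <;> linarith)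
  obtain ⟨k, -, hk⟩ := Finset.exists_ne_zero_of_sum_ne_zero (by rw [hs]; exact one_ne_zero)
  have h₁ := hb.one_le_repr hx hpos (left_ne_zero_of_mul hk)
  have h₂ := (hf k).resolve_left (right_ne_zero_of_mul hk)
  have h₃ := Finset.add_sum_erase Finset.univ (fun k => b'.repr x k * f (b' k))
    (Finset.mem_univ k)
  rw [hs] at h₃
  have h₄ : 0 ≤ ∑ l ∈ Finset.univ.erase k, b'.repr x l * f (b' l) :=
    Finset.sum_nonneg fun l _ => hnn l
  have h₅ : ∑ l ∈ Finset.univ.erase k, b'.repr x l * f (b' l) = 0 := by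
    nlinarith
  refine ⟨k, by nlinarith, by nlinarith, fun l hl hfl => ?_⟩
  have := (Finset.sum_eq_zero_iff_of_nonneg fun l _ => hnn l).1 h₅ l (by simp [hl])
  exact (mul_eq_zero.1 this).resolve_right hfl

/-- The sum of the coordinates outside the set `s`. -/
def heightOutside (b : Basis ι ℝ W) (s : Set ι) [DecidablePred (· ∈ s)] : W →ₗ[ℝ] ℝ :=
  ∑ j with j ∉ s, b.coord j

theorem heightOutside_apply (b : Basis ι ℝ W) (s : Set ι) [DecidablePred (· ∈ s)] (x : W) :
    heightOutside b s x = ∑ j with j ∉ s, b.repr x j := by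
  simp [heightOutside]

theorem heightOutside_basis (b : Basis ι ℝ W) (s : Set ι) [DecidablePred (· ∈ s)] {j : ι}
    (hj : j ∉ s) : heightOutside b s (b j) = 1 := by
  classical
  rw [heightOutside_apply, Finset.sum_eq_single j]
  · simp
  · intro k _ hk
    simp [hk.symm]
  · simp [hj]

theorem IsRootBasis.one_le_heightOutside (hb : IsRootBasis R b) (s : Set ι)
    [DecidablePred (· ∈ s)] {x : W} (hx : x ∈ R) (hpos : IsPos b x) {j : ι} (hj : j ∉ s)
    (h : 0 < b.repr x j) : 1 ≤ heightOutside b s x := by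
  rw [heightOutside_apply]
  exact (hb.one_le_repr hx hpos h.ne').trans
    (Finset.single_le_sum (f := fun j => b.repr x j) (fun k _ => hpos k) (by simp [hj]))

theorem exists_repr_pos' (hR : IsReducedSet R) {x : W} (hx : x ∈ R) (hpos : IsPos b x) :
    ∃ j, 0 < b.repr x j := by
  by_contra! H
  exact hR.ne_zero hx
    (b.repr.injective (Finsupp.ext fun j => by simpa using le_antisymm (H j) (hpos j)))

/-- The height with respect to `b` is at least `1` on every `b' k` and equals `1` on `b j`, so `b j`
cannot be a sum of several members of `b'`. -/
theorem exists_eq_of_isPos (hR : IsReducedSet R) (hb : IsRootBasis R b) (hb' : IsRootBasis R b')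
    (h : ∀ k, IsPos b (b' k)) (j : ι) : ∃ k, b' k = b j := by
  classical
  have hpos : IsPos b' (b j) := (hb'.pos_or_neg _ (hb.mem j)).resolve_right fun hn =>
    not_isPos_neg_basis b j (isPos_of_isPos h hn)
  have hf : ∀ k, 1 ≤ heightOutside b ∅ (b' k) := fun k => by
    obtain ⟨l, hl⟩ := exists_repr_pos' hR (hb'.mem k) (h k)
    exact hb.one_le_heightOutside ∅ (hb'.mem k) (h k) (by simp) hl
  obtain ⟨k, hk, -, h0⟩ := hb'.exists_repr_eq_one (heightOutside b ∅) (hb.mem j) hpos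
    (heightOutside_basis b ∅ (by simp)) fun k => Or.inr (hf k)
  refine ⟨k, ?_⟩
  rw [← b'.sum_repr (b j), Finset.sum_eq_single k, hk, one_smul]
  · intro l _ hl
    rw [h0 l hl (by linarith [hf l]), zero_smul]
  · simp

/-- Root bases with the same nonnegative roots agree up to the ordering. -/
theorem exists_equiv_of_isPos (hR : IsReducedSet R) (hb : IsRootBasis R b)
    (hb' : IsRootBasis R b') (h : ∀ k, IsPos b (b' k)) : ∃ e : ι ≃ κ, ∀ j, b' (e j) = b j := by
  choose e he using exists_eq_of_isPos hR hb hb' h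
  have hinj : Function.Injective e := fun j k hjk => b.injective (by rw [← he, ← he, hjk])
  have hc : Fintype.card ι = Fintype.card κ := by
    rw [← finrank_eq_card_basis b, ← finrank_eq_card_basis b']
  exact ⟨Equiv.ofBijective e ((Fintype.bijective_iff_injective_and_card e).2 ⟨hinj, hc⟩), he⟩

/-- If the nonnegative roots of two root bases differ only in `± b i`, then the bases are
related by a step, up to the ordering. -/
theorem exists_equiv_of_isPos_iff [DecidableEq ι] (hR : IsReducedSet R) (hb : IsRootBasis R b)
    (hb' : IsRootBasis R b') (i : ι)
    (h : ∀ x ∈ R, x ≠ b i → IsPos b x → IsPos b' x) (hi : ¬IsPos b' (b i)) :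
    ∃ (e : ι ≃ κ) (c : ι → ℕ), b' (e i) = -b i ∧ ∀ j, j ≠ i → b' (e j) = b j + c j • b i := by
  classical
  -- The height modulo `b i`: it vanishes on `b i`, is `1` on the other `b j`, and is at least `1`
  -- on every `b' k` other than `-b i`.
  set f := heightOutside b {i} with hf
  have hfi : f (b i) = 0 := by
    rw [hf, heightOutside_apply]
    exact Finset.sum_eq_zero fun k hk => by
      have : i ≠ k := fun h => by simp [h] at hk
      simp [this]
  have hcase : ∀ k, b' k = -b i ∨ 1 ≤ f (b' k) := by
    intro k
    by_cases hk : b' k = -b i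
    · exact Or.inl hk
    right
    have hpos : IsPos b (b' k) := by
      refine (hb.pos_or_neg _ (hb'.mem k)).resolve_right fun hn => ?_
      exact not_isPos_neg_basis b' k (h _ (hR.neg_mem _ (hb'.mem k))
        (fun h => hk (by rw [← h, neg_neg])) hn)
    have hne : b' k ≠ b i := fun h => hi (h ▸ isPos_basis b' k)
    obtain ⟨j, hj, hlt⟩ := exists_repr_pos hR (hb.mem i) (hb'.mem k) hpos hne
    exact hb.one_le_heightOutside {i} (hb'.mem k) hpos (by simpa using hj) hlt
  have hneg : IsPos b' (-b i) := (hb'.isPos_neg_iff hR (hb.mem i)).2 hi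
  have hf' : ∀ k, f (b' k) = 0 ∨ 1 ≤ f (b' k) := fun k =>
    (hcase k).imp (fun h => by rw [h, map_neg, hfi, neg_zero]) id
  -- Otherwise `f` would be positive on all of `b'`, hence on the positive root `-b i`, where it
  -- vanishes.
  obtain ⟨k₀, hk₀⟩ : ∃ k, b' k = -b i := by
    by_contra! H
    have h₁ : ∀ k, 1 ≤ f (b' k) := fun k => (hcase k).resolve_left (H k)
    obtain ⟨k, hk⟩ := exists_repr_pos' hR (hR.neg_mem _ (hb.mem i)) hneg
    have : 0 < f (-b i) := by
      rw [← b'.sum_repr (-b i), map_sum]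
      refine Finset.sum_pos' (fun l _ => ?_) ⟨k, Finset.mem_univ k, ?_⟩
      · rw [map_smul]; exact mul_nonneg (hneg l) (by linarith [h₁ l])
      · rw [map_smul]; exact mul_pos hk (by linarith [h₁ k])
    rw [map_neg, hfi, neg_zero] at this
    exact lt_irrefl _ this
  have hex : ∀ j, j ≠ i → ∃ k, ∃ n : ℕ, b' k = b j + n • b i := by
    intro j hj
    have hpos : IsPos b' (b j) :=
      h _ (hb.mem j) (fun h => hj (b.injective h)) (isPos_basis b j)
    obtain ⟨k, hk, hfk, h0⟩ := hb'.exists_repr_eq_one f (hb.mem j) hpos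
      (heightOutside_basis b {i} (by simpa using hj)) hf'
    obtain ⟨n, hn⟩ := hb'.integral _ (hb.mem j) k₀
    have hn0 : 0 ≤ n := by
      have := hpos k₀
      rw [hn] at this
      exact_mod_cast this
    lift n to ℕ using hn0
    have hkk : k ≠ k₀ := by
      rintro rfl
      rw [hk₀, map_neg, hfi] at hfk
      norm_num at hfk
    refine ⟨k, n, ?_⟩
    -- Besides `b' k`, only the direction `b' k₀ = -b i` is invisible to `f` and can occur; its
    -- coordinate is the coefficient of the step.
    have hs : b j = b' k + (n : ℝ) • b' k₀ := by
      conv_lhs => rw [← b'.sum_repr (b j), ← Finset.add_sum_erase _ _ (Finset.mem_univ k)]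
      rw [hk, one_smul, Finset.sum_eq_single k₀, hn]
      · simp
      · intro l hl hl₀
        have : f (b' l) ≠ 0 := by
          rcases hcase l with h | h
          · exact absurd (b'.injective (h.trans hk₀.symm)) hl₀
          · linarith
        rw [h0 l (Finset.ne_of_mem_erase hl) this, zero_smul]
      · intro h
        simp [hkk.symm] at h
    rw [hs, hk₀, ← Nat.cast_smul_eq_nsmul ℝ]
    module
  have hex' : ∀ j, ∃ k, ∃ n : ℕ, (j = i → b' k = -b i) ∧ (j ≠ i → b' k = b j + n • b i) := by
    intro j
    by_cases hj : j = i
    · exact ⟨k₀, 0, fun _ => hk₀, fun h => absurd hj h⟩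
    · obtain ⟨k, n, hk⟩ := hex j hj
      exact ⟨k, n, fun h => absurd h hj, fun _ => hk⟩
  choose e c he₁ he₂ using hex'
  have hinj : Function.Injective e := by
    intro j k hjk
    by_contra hne
    have hco := congrArg (fun l => b.repr (b' l)) hjk
    by_cases hj : j = i
    · have hk : k ≠ i := fun hk => hne (hj.trans hk.symm)
      rw [he₁ j hj, he₂ k hk] at hco
      have := DFunLike.congr_fun hco k
      simp [hk.symm] at this
    · by_cases hk : k = i
      · rw [he₂ j hj, he₁ k hk] at hco
        have := DFunLike.congr_fun hco j
        simp [Ne.symm hj] at this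
      · rw [he₂ j hj, he₂ k hk] at hco
        have := DFunLike.congr_fun hco j
        simp [Ne.symm hj, Ne.symm hne] at this
  have hc : Fintype.card ι = Fintype.card κ := by
    rw [← finrank_eq_card_basis b, ← finrank_eq_card_basis b']
  exact ⟨Equiv.ofBijective e ((Fintype.bijective_iff_injective_and_card e).2 ⟨hinj, hc⟩), c,
    he₁ i rfl, he₂⟩

end

end RootBasis

/-! ### Alternating walks in rank two -/

namespace RootBasis

variable {W : Type*} [AddCommGroup W] [Module ℝ W] {ι : Type*}

/-- The nonnegative elements of `R` in the plane spanned by `b i` and `b j`. -/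
def planeRoots (R : Set W) (b : Basis ι ℝ W) (i j : ι) : Set W :=
  {x | x ∈ R ∧ IsPos b x ∧ ∀ k, k ≠ i → k ≠ j → b.repr x k = 0}

/-- A sequence of root bases such that consecutive members are related by a step, alternatingly
in the directions `i` and `j`. -/
structure IsAlternatingWalk (R : Set W) (i j : ι) (B : ℕ → Basis ι ℝ W) (l : ℕ → ι) : Prop where
  ne : i ≠ j
  rootBasis : ∀ n, IsRootBasis R (B n)
  mem : ∀ n, l n = i ∨ l n = j
  alternate : ∀ n, l (n + 1) ≠ l n
  step : ∀ n, IsStep (B n) (l n) (B (n + 1))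

namespace IsAlternatingWalk

variable {R : Set W} {i j : ι} {B : ℕ → Basis ι ℝ W} {l : ℕ → ι}

theorem shift (h : IsAlternatingWalk R i j B l) (m : ℕ) :
    IsAlternatingWalk R i j (fun n => B (m + n)) (fun n => l (m + n)) where
  ne := h.ne
  rootBasis _ := h.rootBasis _
  mem _ := h.mem _
  alternate n := h.alternate (m + n)
  step n := h.step (m + n)

theorem repr_eq (h : IsAlternatingWalk R i j B l) (n : ℕ) {k : ι} (hi : k ≠ i) (hj : k ≠ j)
    (x : W) : (B n).repr x k = (B 0).repr x k := by
  induction n with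
  | zero => rfl
  | succ n ih =>
    rw [← ih]
    exact (h.step n).repr_eq (by rcases h.mem n with e | e <;> rw [e] <;> assumption) x

theorem repr_basis_eq_zero (h : IsAlternatingWalk R i j B l) (n m : ℕ) {k : ι} (hi : k ≠ i)
    (hj : k ≠ j) : (B 0).repr (B n (l m)) k = 0 := by
  classical
  rw [← h.repr_eq n hi hj, Basis.repr_self, Finsupp.single_apply, if_neg]
  rintro rfl
  rcases h.mem m with e | e
  · exact hi e
  · exact hj e

/-- Elements of `R` outside the plane keep their sign. -/
theorem isPos_iff (h : IsAlternatingWalk R i j B l) (n : ℕ) {x : W}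
    (hx : x ∈ R) {k : ι} (hi : k ≠ i) (hj : k ≠ j) (hk : (B 0).repr x k ≠ 0) :
    IsPos (B n) x ↔ IsPos (B 0) x := by
  have key : ∀ p q : ℕ, IsPos (B p) x → IsPos (B q) x := by
    intro p q hp
    refine ((h.rootBasis q).pos_or_neg x hx).resolve_right fun hn => hk (le_antisymm ?_ ?_)
    · have := hn k
      rw [h.repr_eq q hi hj] at this
      simpa using this
    · rw [← h.repr_eq p hi hj]
      exact hp k
  exact ⟨key _ _, key _ _⟩

/-- The elements of `R` whose sign differs at the `n`-th basis. -/
def flipped (R : Set W) (i j : ι) (B : ℕ → Basis ι ℝ W) (n : ℕ) : Set W :=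
  {x | x ∈ planeRoots R (B 0) i j ∧ ¬IsPos (B n) x}

theorem planeRoots_finite (hR : IsReducedSet R) (b : Basis ι ℝ W) :
    (planeRoots R b i j).Finite :=
  hR.finite.subset fun _ h => h.1

/-- Each step has determinant `-1` in the plane. After an even number of steps this excludes that
the two basis vectors have been exchanged. -/
theorem area_eq (h : IsAlternatingWalk R i j B l) (n : ℕ) :
    (B 0).repr (B n i) i * (B 0).repr (B n j) j - (B 0).repr (B n i) j * (B 0).repr (B n j) i =
      (-1) ^ n := by
  induction n with
  | zero => simp [h.ne, h.ne.symm]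
  | succ n ih =>
    rw [pow_succ, ← ih]
    rcases h.mem n with e | e
    · have hs := h.step n
      rw [e] at hs
      obtain ⟨c, hc⟩ := hs.2 j h.ne.symm
      rw [hs.1, hc]
      simp only [map_neg, map_add, map_smul, Finsupp.neg_apply, Finsupp.add_apply,
        Finsupp.smul_apply, smul_eq_mul]
      ring
    · have hs := h.step n
      rw [e] at hs
      obtain ⟨c, hc⟩ := hs.2 i h.ne
      rw [hs.1, hc]
      simp only [map_neg, map_add, map_smul, Finsupp.neg_apply, Finsupp.add_apply,
        Finsupp.smul_apply, smul_eq_mul]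
      ring

variable [Fintype ι]

/-- Each step flips exactly one new root, as long as unflipped ones remain. The second conclusion
keeps the induction going: the plane vector of `B n` in the direction just crossed is negative. If
the other one were negative too, every plane root positive at `B n` would be negative at `B 0`,
contradicting an unflipped root. -/
theorem card_flipped (hR : IsReducedSet R) (h : IsAlternatingWalk R i j B l) (n : ℕ) :
    n ≤ (planeRoots R (B 0) i j).ncard →
    (flipped R i j B n).ncard = n ∧ ∀ p, n = p + 1 → IsPos (B 0) (-B n (l p)) := by
  classical
  induction n with
  | zero =>
    intro _
    refine ⟨?_, by simp⟩
    have : flipped R i j B 0 = ∅ := by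
      ext x
      simp only [flipped, Set.mem_ofPred_eq, Set.mem_empty_iff_false, iff_false]
      exact fun hx => hx.2 hx.1.2.1
    rw [this, Set.ncard_empty]
  | succ n ih =>
    intro hn
    obtain ⟨ihc, ihp⟩ := ih (by omega)
    set y := B n (l n) with hy
    have hfin := planeRoots_finite (i := i) (j := j) hR (B 0)
    have hsub : flipped R i j B n ⊆ planeRoots R (B 0) i j := fun _ h => h.1
    obtain ⟨x, hxM, hxF⟩ : ∃ x ∈ planeRoots R (B 0) i j, x ∉ flipped R i j B n := by
      by_contra! H
      have := Set.ncard_le_ncard H (hfin.subset hsub)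
      omega
    have hxn : IsPos (B n) x := by
      by_contra hc
      exact hxF ⟨hxM, hc⟩
    have hyR : y ∈ R := (h.rootBasis n).mem _
    have hypos : IsPos (B 0) y := by
      rcases Nat.eq_zero_or_pos n with rfl | hpos
      · exact isPos_basis _ _
      obtain ⟨p, rfl⟩ : ∃ p, n = p + 1 := ⟨n - 1, by omega⟩
      refine ((h.rootBasis 0).pos_or_neg y hyR).resolve_right fun hneg => ?_
      have hneg' := ihp p rfl
      refine not_isPos_neg (hR.ne_zero hxM.1) hxM.2.1 ?_
      refine isPos_neg_of_support hxn fun k hk => ?_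
      by_cases hkp : k = l p
      · rwa [hkp]
      by_cases hkq : k = l (p + 1)
      · rwa [hkq]
      exfalso
      have hij : k ≠ i ∧ k ≠ j := by
        have h₁ := h.mem p
        have h₂ := h.mem (p + 1)
        have h₃ := h.alternate p
        grind
      refine hk ?_
      rw [h.repr_eq _ hij.1 hij.2]
      exact hxM.2.2 k hij.1 hij.2
    have hyM : y ∈ planeRoots R (B 0) i j :=
      ⟨hyR, hypos, fun k hi hj => h.repr_basis_eq_zero n n hi hj⟩
    have hyF : y ∉ flipped R i j B n := fun hc => hc.2 (isPos_basis _ _)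
    have hins : flipped R i j B (n + 1) = insert y (flipped R i j B n) := by
      ext z
      rw [Set.mem_insert_iff]
      by_cases hz : z = y
      · simp only [hz, true_or, iff_true]
        exact ⟨hyM, (h.step n).not_isPos⟩
      · simp only [hz, false_or]
        refine and_congr_right fun hzM => not_congr ?_
        refine (h.step n).isPos_iff hR (h.rootBasis n) (h.rootBasis (n + 1)) hzM.1 hz fun hc => ?_
        exact not_isPos_neg (hR.ne_zero hyR) hypos (hc ▸ hzM.2.1)
    refine ⟨?_, fun p hp => ?_⟩
    · rw [hins, Set.ncard_insert_of_notMem hyF (hfin.subset hsub), ihc]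
    · obtain rfl : n = p := by omega
      rw [(h.step n).1, neg_neg]
      exact hypos

theorem flipped_eq (hR : IsReducedSet R) (h : IsAlternatingWalk R i j B l) :
    flipped R i j B (planeRoots R (B 0) i j).ncard = planeRoots R (B 0) i j :=
  Set.eq_of_subset_of_ncard_le (fun _ h => h.1) (h.card_flipped hR _ le_rfl).1.ge
    (planeRoots_finite hR _)

/-- Half way, the nonnegative elements of `R` in the plane are replaced by their negatives. -/
theorem planeRoots_half (hR : IsReducedSet R) (h : IsAlternatingWalk R i j B l) :
    planeRoots R (B (planeRoots R (B 0) i j).ncard) i j = Neg.neg '' planeRoots R (B 0) i j := by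
  set m := (planeRoots R (B 0) i j).ncard with hm
  have hf := h.flipped_eq hR
  rw [← hm] at hf
  have key : ∀ x ∈ planeRoots R (B 0) i j, IsPos (B m) (-x) := fun x hx =>
    ((h.rootBasis m).isPos_neg_iff hR hx.1).2 (hf.symm ▸ hx : x ∈ flipped R i j B m).2
  ext y
  constructor
  · rintro ⟨hy, hpos, h0⟩
    refine ⟨-y, ⟨hR.neg_mem y hy, ?_, fun k hi hj => ?_⟩, neg_neg y⟩
    · refine ((h.rootBasis 0).isPos_neg_iff hR hy).2 fun hc => ?_
      exact not_isPos_neg (hR.ne_zero hy) hpos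
        (key y ⟨hy, hc, fun k hi hj => by rw [← h.repr_eq m hi hj]; exact h0 k hi hj⟩)
    · rw [map_neg, Finsupp.neg_apply, ← h.repr_eq m hi hj, h0 k hi hj, neg_zero]
  · rintro ⟨x, hx, rfl⟩
    refine ⟨hR.neg_mem x hx.1, key x hx, fun k hi hj => ?_⟩
    rw [map_neg, Finsupp.neg_apply, h.repr_eq m hi hj, hx.2.2 k hi hj, neg_zero]

theorem ncard_planeRoots_half (hR : IsReducedSet R) (h : IsAlternatingWalk R i j B l) :
    (planeRoots R (B (planeRoots R (B 0) i j).ncard) i j).ncard =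
      (planeRoots R (B 0) i j).ncard := by
  rw [h.planeRoots_half hR, Set.ncard_image_of_injective _ neg_injective]

/-- Strictly between the start and twice the number of nonnegative roots in the plane, some root
has changed its sign. -/
theorem flipped_nonempty (hR : IsReducedSet R) (h : IsAlternatingWalk R i j B l) {n : ℕ}
    (h₀ : 0 < n) (hn : n < 2 * (planeRoots R (B 0) i j).ncard) :
    (flipped R i j B n).Nonempty := by
  set m := (planeRoots R (B 0) i j).ncard with hm
  rcases le_or_gt n m with hnm | hnm
  · have := (h.card_flipped hR n hnm).1
    exact Set.nonempty_of_ncard_ne_zero (by omega)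
  -- Past the half-way point the walk is restarted at `B m`, where the positive plane roots are the
  -- negatives of the original ones. It has flipped back only `p < m` of them.
  obtain ⟨p, rfl⟩ : ∃ p, n = m + p := ⟨n - m, by omega⟩
  have hc : (planeRoots R (B (m + 0)) i j).ncard = m := h.ncard_planeRoots_half hR
  have h' := h.shift m
  obtain ⟨hcard, -⟩ := h'.card_flipped hR p (by rw [hc]; omega)
  obtain ⟨x, hx, hxF⟩ : ∃ x ∈ planeRoots R (B (m + 0)) i j,
      x ∉ flipped R i j (fun n => B (m + n)) p := by
    by_contra! H
    have := Set.ncard_le_ncard H ((planeRoots_finite hR _).subset fun _ h => h.1)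
    omega
  have hpos : IsPos (B (m + p)) x := by
    by_contra hc
    exact hxF ⟨hx, hc⟩
  have hx' : x ∈ Neg.neg '' planeRoots R (B 0) i j := by
    rw [← h.planeRoots_half hR]
    exact hx
  obtain ⟨y, hy, rfl⟩ := hx'
  exact ⟨y, hy, ((h.rootBasis _).isPos_neg_iff hR hy.1).1 hpos⟩

theorem isPos_full (hR : IsReducedSet R) (h : IsAlternatingWalk R i j B l) {x : W} (hx : x ∈ R)
    (hpos : IsPos (B 0) x) : IsPos (B (2 * (planeRoots R (B 0) i j).ncard)) x := by
  set m := (planeRoots R (B 0) i j).ncard with hm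
  by_cases hk : ∀ k, k ≠ i → k ≠ j → (B 0).repr x k = 0
  · have hc : (planeRoots R (B (m + 0)) i j).ncard = m := h.ncard_planeRoots_half hR
    have hxm : -x ∈ planeRoots R (B (m + 0)) i j := by
      change -x ∈ planeRoots R (B m) i j
      rw [h.planeRoots_half hR]
      exact ⟨x, ⟨hx, hpos, hk⟩, rfl⟩
    have hf := (h.shift m).flipped_eq hR
    rw [hc] at hf
    rw [← hf] at hxm
    rw [two_mul]
    by_contra hcon
    exact hxm.2 (((h.rootBasis _).isPos_neg_iff hR hx).2 hcon)
  · push Not at hk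
    obtain ⟨k, hi, hj, hk⟩ := hk
    exact (h.isPos_iff _ hx hi hj hk).2 hpos

/-- The rank two relation: the alternating walk returns to the initial basis after twice as many
steps as there are nonnegative roots in the plane. -/
theorem full_eq (hR : IsReducedSet R) (h : IsAlternatingWalk R i j B l) :
    B (2 * (planeRoots R (B 0) i j).ncard) = B 0 := by
  classical
  set m := (planeRoots R (B 0) i j).ncard with hm
  have hpos : ∀ k, IsPos (B (2 * m)) (B 0 k) := fun k =>
    h.isPos_full hR ((h.rootBasis 0).mem k) (isPos_basis _ _)
  -- The final and initial bases have the same positive roots and so differ by a permutation `e`. It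
  -- fixes all indices outside `i` and `j`, as those coordinates never change, and the determinant
  -- forbids a swap.
  obtain ⟨e, he⟩ := exists_equiv_of_isPos hR (h.rootBasis (2 * m)) (h.rootBasis 0) hpos
  have hout : ∀ k, k ≠ i → k ≠ j → e k = k := by
    intro k hi hj
    have := h.repr_eq (2 * m) hi hj (B (2 * m) k)
    rw [Basis.repr_self, ← he k, Basis.repr_self, Finsupp.single_apply, Finsupp.single_apply,
      if_pos rfl] at this
    by_contra hne
    rw [if_neg hne] at this
    exact one_ne_zero this
  have harea := h.area_eq (2 * m)
  rw [← he i, ← he j, pow_mul] at harea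
  simp only [Basis.repr_self, Finsupp.single_apply] at harea
  have hcase : ∀ k, k = i ∨ k = j → e k = i ∨ e k = j := by
    intro k hk
    by_contra! hne
    have := e.injective (hout _ hne.1 hne.2)
    rcases hk with rfl | rfl
    · exact hne.1 this
    · exact hne.2 this
  have hij := h.ne
  have hei : e i = i := by
    rcases hcase i (Or.inl rfl) with h₁ | h₁
    · exact h₁
    have h₂ : e j = i := (hcase j (Or.inr rfl)).resolve_right fun h₂ =>
      hij (e.injective (h₁.trans h₂.symm))
    simp [h₁, h₂, hij, hij.symm] at harea
    norm_num at harea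
  have hej : e j = j := (hcase j (Or.inr rfl)).resolve_left fun h₂ =>
      hij (e.injective (hei.trans h₂.symm))
  refine Basis.eq_of_apply_eq fun k => ?_
  rw [← he k]
  by_cases hi : k = i
  · rw [hi, hei]
  by_cases hj : k = j
  · rw [hj, hej]
  rw [hout k hi hj]

end IsAlternatingWalk

end RootBasis

/-! ### Realizations of Cartan schemes by root bases -/

namespace RootBasis

variable {W : Type*} [AddCommGroup W] [Module ℝ W] {ι : Type*} [Fintype ι]

/-- The vector with given integral coordinates. -/
def ofCoords (b : Basis ι ℝ W) : (ι → ℤ) →ₗ[ℤ] W := Fintype.linearCombination ℤ b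

theorem ofCoords_apply (b : Basis ι ℝ W) (x : ι → ℤ) : ofCoords b x = ∑ j, x j • b j := rfl

theorem repr_ofCoords (b : Basis ι ℝ W) (x : ι → ℤ) (i : ι) : b.repr (ofCoords b x) i = x i := by
  classical
  simp only [ofCoords_apply, map_sum, ← Int.cast_smul_eq_zsmul ℝ, map_smul, Basis.repr_self,
    Finsupp.coe_finsetSum, Finset.sum_apply, Finsupp.smul_apply, Finsupp.single_apply]
  simp

theorem ofCoords_injective (b : Basis ι ℝ W) : Function.Injective (ofCoords b) := by
  intro x y h
  funext i
  have := congrArg (fun z => b.repr z i) h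
  simpa [repr_ofCoords] using this

theorem ofCoords_single [DecidableEq ι] (b : Basis ι ℝ W) (i : ι) :
    ofCoords b (Pi.single i 1) = b i := by
  simp [ofCoords]

theorem isPos_ofCoords (b : Basis ι ℝ W) (x : ι → ℤ) : IsPos b (ofCoords b x) ↔ ∀ i, 0 ≤ x i := by
  simp [IsPos, repr_ofCoords]

variable {R : Set W} {b : Basis ι ℝ W}

theorem IsRootBasis.exists_ofCoords (hb : IsRootBasis R b) {x : W} (hx : x ∈ R) :
    ∃ n, ofCoords b n = x := by
  choose n hn using hb.integral x hx
  refine ⟨n, b.repr.injective (Finsupp.ext fun i => ?_)⟩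
  rw [repr_ofCoords, hn]

/-- The height serves as a generic point of the chamber of `b`, in the form of a functional on `W`.
-/
theorem IsRootBasis.height_pos_iff (hR : IsReducedSet R) (hb : IsRootBasis R b) {x : W}
    (hx : x ∈ R) : 0 < heightOutside b ∅ x ↔ IsPos b x := by
  have key : ∀ y ∈ R, IsPos b y → 0 < heightOutside b ∅ y := fun y hy hpos => by
    obtain ⟨j, hj⟩ := exists_repr_pos' hR hy hpos
    linarith [hb.one_le_heightOutside ∅ hy hpos (by simp) hj]
  refine ⟨fun h => (hb.pos_or_neg x hx).resolve_right fun hn => ?_, key x hx⟩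
  have := key _ (hR.neg_mem x hx) hn
  rw [map_neg] at this
  linarith

theorem IsRootBasis.height_ne_zero (hR : IsReducedSet R) (hb : IsRootBasis R b) {x : W}
    (hx : x ∈ R) : heightOutside b ∅ x ≠ 0 := by
  rcases hb.pos_or_neg x hx with h | h
  · exact ((hb.height_pos_iff hR hx).2 h).ne'
  · have := (hb.height_pos_iff hR (hR.neg_mem x hx)).2 h
    rw [map_neg] at this
    linarith

theorem IsStep.symm {ι : Type*} {b b' : Basis ι ℝ W} {i : ι} (h : IsStep b i b') :
    IsStep b' i b := by
  refine ⟨by rw [h.1, neg_neg], fun j hj => ?_⟩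
  obtain ⟨c, hc⟩ := h.2 j hj
  exact ⟨c, by rw [hc, h.1]; module⟩

end RootBasis

namespace CartanQuadruple

open RootBasis

variable {W : Type*} [AddCommGroup W] [Module ℝ W]

/-- A realization of `S` in `R`: root bases attached to the objects, which are changed by the maps
`ρ_i` as described by the matrices. -/
structure Realizes (S : CartanQuadruple.{u, v}) (R : Set W) (β : S.A → Basis S.I ℝ W) : Prop where
  reduced : IsReducedSet R
  rootBasis : ∀ a, IsRootBasis R (β a)
  diag : ∀ a i, S.C a i i = 2
  step : ∀ a i j, β (S.ρ i a) j = β a j - S.C a i j • β a i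

/-- The map `σ_i^a` is the change of coordinates between the bases before and after the step: the
vector in `W` stays fixed. -/
theorem ofCoords_s_of_step (S : CartanQuadruple.{u, v}) {b b' : Basis S.I ℝ W} {a : S.A} {i : S.I}
    (hd : S.C a i i = 2) (hb : ∀ j, b' j = b j - S.C a i j • b i) (x : S.I → ℤ) :
    ofCoords b' (S.s a i x) = ofCoords b x := by
  have : ofCoords b' ∘ₗ S.s a i = ofCoords b := by
    refine (Pi.basisFun ℤ S.I).ext fun j => ?_
    rw [LinearMap.comp_apply, s, Basis.constr_basis, map_sub, map_smul, simpleRoot, simpleRoot,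
      ofCoords_single, ofCoords_single, Pi.basisFun_apply, ofCoords_single, hb j, hb i, hd]
    module
  exact congrArg (fun f => f x) this

/-- The alternating sequence `i, j, i, j, …`. -/
def alternating {I : Type*} (i j : I) (n : ℕ) : I := if Even n then i else j

/-- The objects obtained from `a` by applying `ρ_i`, `ρ_j`, `ρ_i`, … -/
def alternatingWalk (S : CartanQuadruple.{u, v}) (i j : S.I) (a : S.A) : ℕ → S.A
  | 0 => a
  | n + 1 => S.ρ (alternating i j n) (S.alternatingWalk i j a n)

/-- The composition applies `ρ_j` before `ρ_i`, so the walk starts with `j`. -/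
theorem iterate_eq_alternatingWalk (S : CartanQuadruple.{u, v}) (i j : S.I) (a : S.A) (m : ℕ) :
    (S.ρ i ∘ S.ρ j)^[m] a = S.alternatingWalk j i a (2 * m) := by
  induction m with
  | zero => rfl
  | succ m ih =>
    rw [Function.iterate_succ_apply', ih, Nat.mul_succ]
    have : ¬Even (2 * m + 1) := by simp
    simp [alternatingWalk, alternating, this]

namespace Realizes

variable {S : CartanQuadruple.{u, v}} {R : Set W} {β : S.A → Basis S.I ℝ W}

theorem isStep (h : S.Realizes R β) (a : S.A) (i : S.I) : IsStep (β a) i (β (S.ρ i a)) := by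
  refine ⟨?_, fun j _ => ⟨-(S.C a i j : ℝ), ?_⟩⟩
  · rw [h.step, h.diag]
    module
  · rw [h.step, ← Int.cast_smul_eq_zsmul ℝ]
    module

theorem map_ρ_ρ (h : S.Realizes R β) (a : S.A) (i : S.I) : β (S.ρ i (S.ρ i a)) = β a :=
  (h.isStep _ i).unique (h.rootBasis _) (h.rootBasis a) (h.isStep a i).symm

/-- Some object of a realization lies on the positive side of a given functional. -/
theorem exists_pos (h : S.Realizes R β) [Nonempty S.A] (f : W →ₗ[ℝ] ℝ) (hf : ∀ x ∈ R, f x ≠ 0) :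
    ∃ a, ∀ i, 0 < f (β a i) := by
  -- Induction on the number of positive roots with negative value. If `f (β a i) < 0`, crossing
  -- that wall removes `β a i` from this set and adds nothing.
  have key : ∀ n : ℕ, ∀ a, {x | x ∈ R ∧ IsPos (β a) x ∧ f x < 0}.ncard = n →
      ∃ a, ∀ i, 0 < f (β a i) := by
    intro n
    induction n using Nat.strong_induction_on with
    | _ n ih =>
      intro a ha
      by_contra! H
      obtain ⟨i, hi⟩ := H a
      have hmem := (h.rootBasis a).mem i
      have hi' : f (β a i) < 0 := lt_of_le_of_ne hi (hf _ hmem)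
      have hlt : {x | x ∈ R ∧ IsPos (β (S.ρ i a)) x ∧ f x < 0}.ncard < n := by
        rw [← ha]
        refine Set.ncard_lt_ncard ⟨?_, fun hs => ?_⟩
          (h.reduced.finite.subset fun x hx => hx.1)
        · rintro x ⟨hx, hpos, hneg⟩
          refine ⟨hx, ((h.isStep a i).isPos_iff h.reduced (h.rootBasis a) (h.rootBasis _) hx ?_
            ?_).1 hpos, hneg⟩
          · rintro rfl
            exact (h.isStep a i).not_isPos hpos
          · rintro rfl
            rw [map_neg] at hneg
            linarith
        · exact (h.isStep a i).not_isPos (hs ⟨hmem, isPos_basis _ i, hi'⟩).2.1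
      obtain ⟨a', ha'⟩ := ih _ hlt _ rfl
      obtain ⟨j, hj⟩ := H a'
      exact absurd (ha' j) (not_lt.2 hj)
  exact key _ (Classical.arbitrary S.A) rfl

theorem ofCoords_s (h : S.Realizes R β) (a : S.A) (i : S.I) (x : S.I → ℤ) :
    ofCoords (β (S.ρ i a)) (S.s a i x) = ofCoords (β a) x :=
  S.ofCoords_s_of_step (h.diag a i) (h.step a i) x

theorem ofCoords_morphism (h : S.Realizes R β) {a b : S.A} {w} (hw : S.IsMorphism a b w)
    (x : S.I → ℤ) : ofCoords (β b) (w x) = ofCoords (β a) x := by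
  induction hw with
  | id => rfl
  | comp b w i _ ih => rw [LinearMap.comp_apply, h.ofCoords_s, ih]

/-- Every element of `R` is a member of a basis of the realization. -/
theorem exists_eq (h : S.Realizes R β) [Nonempty S.A] (hc : S.IsConnected) {y : W} (hy : y ∈ R) :
    ∃ a j, β a j = y := by
  -- A step flips only `± β b i`, so a walk along which `y` changes from positive to negative meets
  -- an object whose basis contains `y`.
  have walk : ∀ a b w, S.IsMorphism a b w → IsPos (β a) y → ¬IsPos (β b) y → ∃ a j, β a j = y := by
    intro a b w hw ha
    induction hw with
    | id => exact fun hb => absurd ha hb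
    | comp b w i _ ih =>
      intro hb
      by_cases hpos : IsPos (β b) y
      · by_contra! hne
        refine hb (((h.isStep b i).isPos_iff h.reduced (h.rootBasis b) (h.rootBasis _) hy
          (hne b i).symm fun hyi => ?_).2 hpos)
        exact not_isPos_neg_basis (β b) i (hyi ▸ hpos)
      · exact ih hpos
  obtain a := Classical.arbitrary S.A
  -- The object `a'` is opposite to `a`: every root changes sign between them, and walking one way
  -- or the other makes `y` go from positive to negative.
  obtain ⟨a', ha'⟩ := h.exists_pos (-heightOutside (β a) ∅) fun x hx => by
    simpa using (h.rootBasis a).height_ne_zero h.reduced hx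
  have ha' : ∀ i, IsPos (β a) (-β a' i) := fun i => by
    rw [← (h.rootBasis a).height_pos_iff h.reduced (h.reduced.neg_mem _ ((h.rootBasis a').mem i))]
    simpa using ha' i
  have hop : ∀ x, IsPos (β a') x → IsPos (β a) (-x) := by
    intro x hx
    rw [← (β a').sum_repr x, ← Finset.sum_neg_distrib]
    simp only [← smul_neg]
    exact isPos_sum hx ha'
  have hy0 := h.reduced.ne_zero hy
  by_cases hpos : IsPos (β a) y
  · obtain ⟨w, hw⟩ := hc a a'
    exact walk _ _ w hw hpos fun hy' => not_isPos_neg hy0 hpos (hop y hy')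
  · obtain ⟨w, hw⟩ := hc a' a
    refine walk _ _ w hw ?_ hpos
    refine ((h.rootBasis a').pos_or_neg y hy).resolve_right fun hn => hpos ?_
    simpa using hop _ hn

theorem mem_realRoots_iff (h : S.Realizes R β) [Nonempty S.A] (hc : S.IsConnected) (a : S.A)
    (x : S.I → ℤ) : x ∈ S.realRoots a ↔ ofCoords (β a) x ∈ R := by
  constructor
  · rintro ⟨b, w, j, hw, rfl⟩
    rw [h.ofCoords_morphism hw, simpleRoot, ofCoords_single]
    exact (h.rootBasis b).mem j
  · intro hx
    obtain ⟨b, j, hj⟩ := h.exists_eq hc hx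
    obtain ⟨w, hw⟩ := hc b a
    refine ⟨b, w, j, hw, ofCoords_injective (β a) ?_⟩
    rw [h.ofCoords_morphism hw, simpleRoot, ofCoords_single, hj]

theorem image_realRoots (h : S.Realizes R β) [Nonempty S.A] (hc : S.IsConnected) (a : S.A) :
    ofCoords (β a) '' S.realRoots a = R := by
  ext y
  constructor
  · rintro ⟨x, hx, rfl⟩
    exact (h.mem_realRoots_iff hc a x).1 hx
  · intro hy
    obtain ⟨x, rfl⟩ := (h.rootBasis a).exists_ofCoords hy
    exact ⟨x, (h.mem_realRoots_iff hc a x).2 hy, rfl⟩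

theorem image_plane (h : S.Realizes R β) [Nonempty S.A] (hc : S.IsConnected) (a : S.A)
    {i j : S.I} (hij : i ≠ j) :
    ofCoords (β a) '' {x | x ∈ S.realRoots a ∧
      ∃ p q : ℕ, x = p • S.simpleRoot i + q • S.simpleRoot j} = planeRoots R (β a) i j := by
  ext y
  constructor
  · rintro ⟨x, ⟨hx, p, q, hpq⟩, rfl⟩
    refine ⟨(h.mem_realRoots_iff hc a x).1 hx, ?_, fun k hi hj => ?_⟩
    · rw [isPos_ofCoords, hpq]
      intro k
      have hs : ∀ l, 0 ≤ S.simpleRoot l k := fun l => by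
        rw [simpleRoot, Pi.single_apply]
        split_ifs <;> norm_num
      exact add_nonneg (nsmul_nonneg (hs i) p) (nsmul_nonneg (hs j) q)
    · rw [repr_ofCoords, hpq]
      simp [simpleRoot, hi, hj]
  · rintro ⟨hy, hpos, h0⟩
    obtain ⟨x, rfl⟩ := (h.rootBasis a).exists_ofCoords hy
    rw [isPos_ofCoords] at hpos
    refine ⟨x, ⟨(h.mem_realRoots_iff hc a x).2 hy, (x i).toNat, (x j).toNat, ?_⟩, rfl⟩
    funext k
    have hi := Int.toNat_of_nonneg (hpos i)
    have hj := Int.toNat_of_nonneg (hpos j)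
    by_cases hki : k = i
    · subst hki
      simp [simpleRoot, hij, hi]
    by_cases hkj : k = j
    · subst hkj
      simp [simpleRoot, hki, hj]
    · have := h0 k hki hkj
      rw [repr_ofCoords] at this
      simpa [simpleRoot, Pi.single_apply, hki, hkj] using this

theorem ncard_plane (h : S.Realizes R β) [Nonempty S.A] (hc : S.IsConnected) (a : S.A)
    {i j : S.I} (hij : i ≠ j) :
    {x | x ∈ S.realRoots a ∧ ∃ p q : ℕ, x = p • S.simpleRoot i + q • S.simpleRoot j}.ncard =
      (planeRoots R (β a) i j).ncard := by
  rw [← h.image_plane hc a hij, Set.ncard_image_of_injective _ (ofCoords_injective _)]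

theorem isAlternatingWalk (h : S.Realizes R β) (a : S.A) {i j : S.I} (hij : i ≠ j) :
    IsAlternatingWalk R i j (fun n => β (S.alternatingWalk j i a n)) (alternating j i) where
  ne := hij
  rootBasis _ := h.rootBasis _
  mem n := by
    unfold alternating
    split_ifs <;> simp
  alternate n := by
    by_cases hn : Even n
    · simp [alternating, Nat.even_add_one, hn, hij]
    · simp [alternating, Nat.even_add_one, hn, hij.symm]
  step n := h.isStep _ _

theorem nonpos (h : S.Realizes R β) (a : S.A) {i j : S.I} (hij : i ≠ j) : S.C a i j ≤ 0 := by
  have e := h.step a i j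
  rw [← Int.cast_smul_eq_zsmul ℝ] at e
  have hpos : IsPos (β a) (β (S.ρ i a) j) := by
    refine ((h.rootBasis a).pos_or_neg _ ((h.rootBasis _).mem j)).resolve_right fun hn => ?_
    have := hn j
    rw [e] at this
    simp [hij] at this
    linarith
  have := hpos i
  rw [e] at this
  simp [hij.symm] at this
  exact this

/-- If `S.C a j i` were negative, the root `β (ρ_j a) i` would have coordinates of both signs with
respect to `β (ρ_i a)`: `-1` at `i` and `-S.C a j i` at `j`. -/
theorem zero (h : S.Realizes R β) (a : S.A) (i j : S.I) (h0 : S.C a i j = 0) : S.C a j i = 0 := by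
  by_cases hij : i = j
  · rwa [hij] at h0 ⊢
  have e₁ : β (S.ρ i a) j = β a j := by rw [h.step, h0, zero_smul, sub_zero]
  have e₂ : β (S.ρ j a) i = -β (S.ρ i a) i - (S.C a j i : ℝ) • β (S.ρ i a) j := by
    rw [h.step, e₁, (h.isStep a i).1, neg_neg, Int.cast_smul_eq_zsmul]
  by_contra hne
  have hlt : (S.C a j i : ℝ) < 0 := by exact_mod_cast lt_of_le_of_ne (h.nonpos a (Ne.symm hij)) hne
  rcases (h.rootBasis (S.ρ i a)).pos_or_neg _ ((h.rootBasis (S.ρ j a)).mem i) with hp | hp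
  · have := hp i
    rw [e₂] at this
    simp [Ne.symm hij] at this
    linarith
  · have := hp j
    rw [e₂] at this
    simp [hij] at this
    exact absurd (Int.cast_nonneg this) (not_le.2 hlt)

/-- Cartan schemes with injective realizations are of finite type. -/
theorem isFiniteType (h : S.Realizes R β) [Nonempty S.A] [Nonempty S.I] (hc : S.IsConnected)
    (hβ : Function.Injective β) : S.IsFiniteType where
  scheme :=
    { nonempty_I := inferInstance
      nonempty_A := inferInstance
      cartan := fun a => ⟨h.diag a, fun _ _ => h.nonpos a, h.zero a⟩
      ρ_ρ := fun i a => hβ (h.map_ρ_ρ a i)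
      C_ρ := by
        intro i j a
        have e := h.step (S.ρ i a) i j
        rw [h.map_ρ_ρ, h.step a i j, (h.isStep a i).1] at e
        have e' : (S.C (S.ρ i a) i j - S.C a i j : ℤ) • β a i = 0 := by
          rw [← sub_eq_zero.2 e.symm]
          module
        rw [← Int.cast_smul_eq_zsmul ℝ, smul_eq_zero] at e'
        have := e'.resolve_right ((β a).ne_zero i)
        have := Int.cast_eq_zero.1 this
        omega }
  connected := hc
  simplyConnected a w hw := LinearMap.ext fun x =>
    ofCoords_injective (β a) (h.ofCoords_morphism hw x)
  rootSystem :=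
    { R1 := by
        intro a
        ext x
        have hn : -x ∈ S.realRoots a ↔ x ∈ S.realRoots a := by
          rw [h.mem_realRoots_iff hc, h.mem_realRoots_iff hc, map_neg]
          exact ⟨fun hx => by simpa using h.reduced.neg_mem _ hx, h.reduced.neg_mem _⟩
        simp only [Set.mem_union, Set.mem_ofPred_eq, hn, ← and_or_left]
        refine ⟨fun hx => ⟨hx, ?_⟩, fun hx => hx.1⟩
        have := (h.rootBasis a).pos_or_neg _ ((h.mem_realRoots_iff hc a x).1 hx)
        rwa [← map_neg, isPos_ofCoords, isPos_ofCoords] at this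
      R2 := by
        intro a i
        have hi : ofCoords (β a) (S.simpleRoot i) = β a i := ofCoords_single _ i
        ext x
        simp only [Set.mem_ofPred_eq, Set.mem_insert_iff, Set.mem_singleton_iff]
        constructor
        · rintro ⟨hx, t, rfl⟩
          rw [h.mem_realRoots_iff hc, map_smul, hi, ← Int.cast_smul_eq_zsmul ℝ] at hx
          rcases h.reduced.reduced _ ((h.rootBasis a).mem i) _ hx with ht | ht
          · left
            have : t = 1 := by exact_mod_cast ht
            rw [this, one_smul]
          · right
            have : t = -1 := by exact_mod_cast ht
            rw [this, neg_smul, one_smul]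
        · rintro (rfl | rfl)
          · refine ⟨?_, 1, by simp⟩
            rw [h.mem_realRoots_iff hc, hi]
            exact (h.rootBasis a).mem i
          · refine ⟨?_, -1, by simp⟩
            rw [h.mem_realRoots_iff hc, map_neg, hi]
            exact h.reduced.neg_mem _ ((h.rootBasis a).mem i)
      R3 := by
        intro a i
        ext y
        constructor
        · rintro ⟨x, hx, rfl⟩
          rw [h.mem_realRoots_iff hc] at hx ⊢
          rwa [h.ofCoords_s]
        · intro hy
          rw [h.mem_realRoots_iff hc] at hy
          have e := h.ofCoords_s (S.ρ i a) i y
          rw [h.map_ρ_ρ] at e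
          refine ⟨S.s (S.ρ i a) i y, ?_, ofCoords_injective (β (S.ρ i a)) ?_⟩
          · rwa [h.mem_realRoots_iff hc, e]
          · rw [h.ofCoords_s, e]
      R4 := by
        intro a i j hij _
        rw [iterate_eq_alternatingWalk, h.ncard_plane hc a hij]
        exact hβ ((h.isAlternatingWalk a hij).full_eq h.reduced) }
  finite a := by
    refine Set.Finite.of_finite_image (f := ofCoords (β a)) ?_ (ofCoords_injective _).injOn
    rw [h.image_realRoots hc]
    exact h.reduced.finite

end Realizes

/-! ### Realizations in isomorphic sets of roots -/

section

variable {W' : Type*} [AddCommGroup W'] [Module ℝ W']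
  {S : CartanQuadruple.{u, v}} {R : Set W} {β : S.A → Basis S.I ℝ W}
  {T : CartanQuadruple.{u', v'}} {R' : Set W'} {β' : T.A → Basis T.I ℝ W'}

/-- Schemes with injective realizations in isomorphic sets of roots are equivalent. -/
theorem Realizes.equivalent (h : S.Realizes R β) [Nonempty S.A] (hc : S.IsConnected)
    (hβ : Function.Injective β) (h' : T.Realizes R' β') [Nonempty T.A] (hc' : T.IsConnected)
    (hβ' : Function.Injective β') (ψ : W ≃ₗ[ℝ] W') (hψ : ψ '' R = R') : S.Equivalent T := by
  subst hψ
  obtain b₀ := Classical.arbitrary T.A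
  -- An object of `S` whose chamber is carried by `ψ` to that of `b₀`; comparing the two bases
  -- yields the bijection `e` of the labels.
  obtain ⟨a₀, ha₀⟩ := h.exists_pos (heightOutside (β' b₀) ∅ ∘ₗ ψ.toLinearMap) fun x hx =>
    (h'.rootBasis b₀).height_ne_zero h'.reduced ⟨x, hx, rfl⟩
  have hroot : ∀ a, IsRootBasis (ψ '' R) ((β a).map ψ) := fun a => (h.rootBasis a).map ψ
  obtain ⟨e, he⟩ := exists_equiv_of_isPos h'.reduced (h'.rootBasis b₀) (hroot a₀) fun k => by
    rw [← (h'.rootBasis b₀).height_pos_iff h'.reduced ((hroot a₀).mem k)]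
    simpa using ha₀ k
  -- Objects correspond when they have the same relabelled basis. Uniqueness of steps propagates
  -- this along `ρ`, connectedness makes it total on both sides, and injectivity of the realizations
  -- makes it a bijection.
  let Q : S.A → T.A → Prop := fun a b => ((β a).map ψ).reindex e.symm = β' b
  have hQ₀ : Q a₀ b₀ := Basis.eq_of_apply_eq fun j => by
    rw [← he j]
    simp
  have hQ : ∀ a b i, Q a b → Q (S.ρ i a) (T.ρ (e.symm i) b) := by
    intro a b i hab
    have hs : IsStep (β' b) (e.symm i) (((β (S.ρ i a)).map ψ).reindex e.symm) := by
      rw [← show _ = β' b from hab]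
      refine ⟨by simp [(h.isStep a i).1], fun j hj => ?_⟩
      obtain ⟨c, hc⟩ := (h.isStep a i).2 (e j) fun hji => hj (by rw [← hji, e.symm_apply_apply])
      exact ⟨c, by simp [hc]⟩
    exact hs.unique ((hroot _).reindex _) (h'.rootBasis _) (h'.isStep b _)
  have hC : ∀ a b i j, Q a b → T.C b (e.symm i) (e.symm j) = S.C a i j := by
    intro a b i j hab
    have e₀ : ∀ k, ψ (β a k) = β' b (e.symm k) := fun k => by
      rw [← show _ = β' b from hab]
      simp
    have e₁ : ψ (β (S.ρ i a) j) = β' (T.ρ (e.symm i) b) (e.symm j) := by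
      rw [← show _ = β' (T.ρ (e.symm i) b) from hQ a b i hab]
      simp
    rw [h.step, h'.step, map_sub, map_zsmul, e₀, e₀, sub_right_inj, ← Int.cast_smul_eq_zsmul ℝ,
      ← Int.cast_smul_eq_zsmul ℝ] at e₁
    exact_mod_cast (smul_left_injective ℝ ((β' b).ne_zero _) e₁).symm
  have hex : ∀ a, ∃ b, Q a b := by
    intro a
    obtain ⟨w, hw⟩ := hc a₀ a
    induction hw with
    | id => exact ⟨b₀, hQ₀⟩
    | comp a w i _ ih =>
      obtain ⟨b, hb⟩ := ih
      exact ⟨_, hQ a b i hb⟩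
  have hex' : ∀ b, ∃ a, Q a b := by
    intro b
    obtain ⟨w, hw⟩ := hc' b₀ b
    induction hw with
    | id => exact ⟨a₀, hQ₀⟩
    | comp b w i _ ih =>
      obtain ⟨a, ha⟩ := ih
      have := hQ a b (e i) ha
      rw [e.symm_apply_apply] at this
      exact ⟨_, this⟩
  choose φ hφ using hex
  have huniq : ∀ a b, Q a b → φ a = b := fun a b hab => hβ' ((hφ a).symm.trans hab)
  have hbij : Function.Bijective φ := by
    refine ⟨fun a a' haa => hβ (Basis.eq_of_apply_eq fun i => ψ.injective ?_), fun b => ?_⟩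
    · have h₁ := hφ a
      rw [haa] at h₁
      have := congrArg (fun c : Basis T.I ℝ W' => c (e.symm i)) (h₁.trans (hφ a').symm)
      simpa using this
    · obtain ⟨a, ha⟩ := hex' b
      exact ⟨a, huniq a b ha⟩
  exact ⟨e.symm, Equiv.ofBijective φ hbij, fun i a => huniq _ _ (hQ _ _ i (hφ a)),
    fun i j a => hC _ _ i j (hφ a)⟩

/-- The sets of roots of equivalent schemes are isomorphic. -/
theorem Realizes.exists_linearEquiv (h : S.Realizes R β) [Nonempty S.A] (hc : S.IsConnected)
    (h' : T.Realizes R' β') (hc' : T.IsConnected) (hST : S.Equivalent T) :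
    ∃ ψ : W ≃ₗ[ℝ] W', ψ '' R = R' := by
  obtain ⟨φ₀, φ₁, hρ, hC⟩ := hST
  obtain a₀ := Classical.arbitrary S.A
  have : Nonempty T.A := ⟨φ₁ a₀⟩
  let ψ := (β a₀).equiv (β' (φ₁ a₀)) φ₀
  -- The isomorphism matching the bases at one object matches them everywhere, since all further
  -- bases are computed from the Cartan entries alone.
  have key : ∀ a j, ψ (β a j) = β' (φ₁ a) (φ₀ j) := by
    intro a
    obtain ⟨w, hw⟩ := hc a₀ a
    induction hw with
    | id => exact fun j => by simp [ψ]
    | comp a w i _ ih =>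
      intro j
      rw [h.step, hρ, h'.step, map_sub, map_zsmul, ih, ih, hC]
  refine ⟨ψ, ?_⟩
  ext y
  constructor
  · rintro ⟨x, hx, rfl⟩
    obtain ⟨a, j, rfl⟩ := h.exists_eq hc hx
    rw [key]
    exact (h'.rootBasis _).mem _
  · intro hy
    obtain ⟨b, j, rfl⟩ := h'.exists_eq hc' hy
    refine ⟨β (φ₁.symm b) (φ₀.symm j), (h.rootBasis _).mem _, ?_⟩
    rw [key]
    simp

end

end CartanQuadruple

/-! ### Schemes of finite type have injective realizations -/

namespace CartanQuadruple

open RootBasis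

variable {W : Type*} [AddCommGroup W] [Module ℝ W] {S : CartanQuadruple.{u, v}}

theorem IsMorphism.trans {a b c : S.A} {w w'} (h : S.IsMorphism a b w)
    (h' : S.IsMorphism b c w') : S.IsMorphism a c (w' ∘ₗ w) := by
  induction h' with
  | id => exact h
  | comp c w' i _ ih =>
    rw [LinearMap.comp_assoc]
    exact IsMorphism.comp c _ i ih

theorem isMorphism_s (hρ : ∀ i a, S.ρ i (S.ρ i a) = a) (a : S.A) (i : S.I) :
    S.IsMorphism (S.ρ i a) a (S.s (S.ρ i a) i) := by
  have := IsMorphism.comp (S := S) (S.ρ i a) _ i IsMorphism.id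
  rwa [hρ] at this

theorem exists_isMorphism_symm (hρ : ∀ i a, S.ρ i (S.ρ i a) = a) {a b : S.A} {w}
    (h : S.IsMorphism a b w) : ∃ w', S.IsMorphism b a w' := by
  induction h with
  | id => exact ⟨_, IsMorphism.id⟩
  | comp b w i _ ih =>
    obtain ⟨w', hw'⟩ := ih
    exact ⟨_, (isMorphism_s hρ b i).trans hw'⟩

theorem isConnected_of_reach (hρ : ∀ i a, S.ρ i (S.ρ i a) = a) (a₀ : S.A)
    (h : ∀ b, ∃ w, S.IsMorphism a₀ b w) : S.IsConnected := by
  intro a b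
  obtain ⟨w, hw⟩ := h a
  obtain ⟨w', hw'⟩ := exists_isMorphism_symm hρ hw
  obtain ⟨w'', hw''⟩ := h b
  exact ⟨_, hw'.trans hw''⟩

namespace IsFiniteType

theorem comp_eq_id (hS : S.IsFiniteType) {a b : S.A} {w w'} (h : S.IsMorphism a b w)
    (h' : S.IsMorphism b a w') (x : S.I → ℤ) : w' (w x) = x :=
  congrArg (fun f => f x) (hS.simplyConnected a _ (h.trans h'))

theorem morphism_unique (hS : S.IsFiniteType) {a b : S.A} {w w'} (h : S.IsMorphism a b w)
    (h' : S.IsMorphism a b w') : w = w' := by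
  obtain ⟨w'', hw''⟩ := hS.connected b a
  refine LinearMap.ext fun x => ?_
  rw [← hS.comp_eq_id hw'' h (w' x), hS.comp_eq_id h' hw'']

theorem morphism_realRoots {a b : S.A} {w} (h : S.IsMorphism a b w) {x : S.I → ℤ}
    (hx : x ∈ S.realRoots a) : w x ∈ S.realRoots b := by
  obtain ⟨c, w', j, hw', rfl⟩ := hx
  exact ⟨c, _, j, hw'.trans h, rfl⟩

theorem simpleRoot_mem_realRoots (a : S.A) (i : S.I) : S.simpleRoot i ∈ S.realRoots a :=
  ⟨a, _, i, IsMorphism.id, rfl⟩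

theorem neg_mem_realRoots (hS : S.IsFiniteType) {a : S.A} {x : S.I → ℤ} (hx : x ∈ S.realRoots a) :
    -x ∈ S.realRoots a := by
  have h := hx
  rw [hS.rootSystem.R1 a] at h
  rcases h with h | h
  · rw [hS.rootSystem.R1 a]
    exact Or.inr ⟨by simpa using hx, by simpa using h.2⟩
  · exact h.1

/-- The basis `γ` is transported along the walk. Each step is a linear reflection, given by the
functional whose values on the current basis are the row of Cartan entries. -/
theorem exists_basis (hS : S.IsFiniteType) (γ : Basis S.I ℝ W) {a₀ b : S.A} {w}
    (hw : S.IsMorphism a₀ b w) :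
    ∃ B : Basis S.I ℝ W, ∀ x, ofCoords B (w x) = ofCoords γ x := by
  induction hw with
  | id => exact ⟨γ, fun _ => rfl⟩
  | comp b w i _ ih =>
    obtain ⟨B, hB⟩ := ih
    let f : Dual ℝ W := B.constr ℝ fun j => (S.C b i j : ℝ)
    have hf : ∀ j, f (B j) = S.C b i j := fun j => B.constr_basis ℝ _ j
    have hd : S.C b i i = 2 := (hS.scheme.cartan b).diag i
    have h2 : f (B i) = 2 := by rw [hf, hd]; norm_num
    refine ⟨B.map (Module.reflection h2), fun x => ?_⟩
    rw [LinearMap.comp_apply, S.ofCoords_s_of_step hd fun j => ?_, hB]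
    rw [Basis.map_apply, Module.reflection_apply, hf, Int.cast_smul_eq_zsmul]

/-- A scheme of finite type is realized in its set of real roots at a given object. -/
theorem exists_realizes (hS : S.IsFiniteType) (γ : Basis S.I ℝ W) :
    ∃ (R : Set W) (β : S.A → Basis S.I ℝ W), S.Realizes R β := by
  obtain ⟨a₀⟩ := hS.scheme.nonempty_A
  choose w hw using hS.connected a₀
  choose B hB using fun b => hS.exists_basis γ (hw b)
  have himg : ∀ b, ofCoords γ '' S.realRoots a₀ = ofCoords (B b) '' S.realRoots b := by
    intro b
    obtain ⟨w', hw'⟩ := hS.connected b a₀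
    ext y
    constructor
    · rintro ⟨x, hx, rfl⟩
      exact ⟨_, morphism_realRoots (hw b) hx, hB b x⟩
    · rintro ⟨x, hx, rfl⟩
      refine ⟨_, morphism_realRoots hw' hx, ?_⟩
      rw [← hB b, hS.comp_eq_id hw' (hw b)]
  have hneg : ∀ y ∈ ofCoords γ '' S.realRoots a₀, -y ∈ ofCoords γ '' S.realRoots a₀ := by
    rintro _ ⟨x, hx, rfl⟩
    exact ⟨-x, hS.neg_mem_realRoots hx, map_neg _ _⟩
  refine ⟨ofCoords γ '' S.realRoots a₀, B, ⟨(hS.finite a₀).image _, hneg, ?_⟩, fun b => ?_,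
    fun b => (hS.scheme.cartan b).diag, fun b i j => ?_⟩
  · rintro _ ⟨_, ⟨b, u, j, hu, rfl⟩, rfl⟩ t ht
    rw [← hB b, hS.comp_eq_id hu (hw b), simpleRoot, ofCoords_single, himg b] at ht
    obtain ⟨y, hy, hyt⟩ := ht
    -- In the coordinates at `b` the given root is a simple root. A real multiple of it lying in `R`
    -- is thus an integral multiple, to which (R2) applies.
    have hco : ∀ k, (y k : ℝ) = if k = j then t else 0 := by
      intro k
      rw [← repr_ofCoords (B b) y k, hyt, map_smul, Finsupp.smul_apply, Basis.repr_self,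
        Finsupp.single_apply]
      by_cases hk : k = j
      · simp [hk]
      · simp [hk, Ne.symm hk]
    have hyj : y = y j • S.simpleRoot j := by
      funext k
      by_cases hk : k = j
      · simp [hk, simpleRoot]
      · have := hco k
        rw [if_neg hk] at this
        have : y k = 0 := by exact_mod_cast this
        simp [hk, simpleRoot, this]
    have ht : (y j : ℝ) = t := by rw [hco, if_pos rfl]
    have h2 := (hS.rootSystem.R2 b j).subset ⟨hy, y j, hyj⟩
    rcases h2 with h2 | h2
    · left
      rw [← ht, h2]
      simp [simpleRoot]
    · right
      rw [← ht, h2]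
      simp [simpleRoot]
  · rw [himg b]
    refine ⟨fun i => ⟨_, simpleRoot_mem_realRoots b i, ofCoords_single _ i⟩, ?_, ?_⟩
    · rintro _ ⟨x, -, rfl⟩ i
      exact ⟨x i, repr_ofCoords _ _ _⟩
    · rintro _ ⟨x, hx, rfl⟩
      rw [← map_neg, isPos_ofCoords, isPos_ofCoords]
      rw [hS.rootSystem.R1 b] at hx
      exact hx.imp And.right And.right
  · have hd : S.C b i i = 2 := (hS.scheme.cartan b).diag i
    let f : Dual ℝ W := (B b).constr ℝ fun j => (S.C b i j : ℝ)
    have hf : ∀ j, f (B b j) = S.C b i j := fun j => (B b).constr_basis ℝ _ j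
    have h2 : f (B b i) = 2 := by rw [hf, hd]; norm_num
    have hB' : ∀ j, (B b).map (Module.reflection h2) j = B b j - S.C b i j • B b i := fun j => by
      rw [Basis.map_apply, Module.reflection_apply, hf, Int.cast_smul_eq_zsmul]
    rw [← hB' j]
    -- Simple connectedness makes the arbitrarily chosen morphisms from `a₀` compatible with steps.
    have hwi : w (S.ρ i b) = S.s b i ∘ₗ w b :=
      hS.morphism_unique (hw _) (IsMorphism.comp b _ i (hw b))
    obtain ⟨w', hw'⟩ := hS.connected (S.ρ i b) a₀
    rw [← ofCoords_single (B (S.ρ i b)), ← ofCoords_single ((B b).map _),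
      ← hS.comp_eq_id hw' (hw (S.ρ i b)) (Pi.single j 1), hB, hwi, LinearMap.comp_apply,
      S.ofCoords_s_of_step hd hB', hB]

end IsFiniteType

/-! ### Ascending walks, inversions and injectivity of realizations -/

/-- The objects that are reached from `a₀` by crossing only hyperplanes that have `a₀` on the
same side. -/
inductive AscentReachable (S : CartanQuadruple.{u, v}) (β : S.A → Basis S.I ℝ W) (a₀ : S.A) :
    S.A → Prop
  | base : AscentReachable S β a₀ a₀
  | step (a : S.A) (i : S.I) (h : AscentReachable S β a₀ a) (hi : IsPos (β a₀) (β a i)) :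
      AscentReachable S β a₀ (S.ρ i a)

/-- The elements of `R` that separate `a` from `a₀`. -/
def inversions (S : CartanQuadruple.{u, v}) (R : Set W) (β : S.A → Basis S.I ℝ W) (a₀ a : S.A) :
    Set W :=
  {x | x ∈ R ∧ IsPos (β a) x ∧ ¬IsPos (β a₀) x}

namespace Realizes

variable {R : Set W} {β : S.A → Basis S.I ℝ W}

theorem finite_inversions (h : S.Realizes R β) (a₀ a : S.A) : (S.inversions R β a₀ a).Finite :=
  h.reduced.finite.subset fun _ hx => hx.1

theorem ncard_inversions_lt (h : S.Realizes R β) {a₀ a : S.A} {i : S.I}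
    (hi : ¬IsPos (β a₀) (β a i)) :
    (S.inversions R β a₀ (S.ρ i a)).ncard < (S.inversions R β a₀ a).ncard := by
  have hmem := (h.rootBasis a).mem i
  refine Set.ncard_lt_ncard ⟨?_, fun hs => ?_⟩ (h.finite_inversions _ _)
  · rintro x ⟨hx, hpos, hneg⟩
    refine ⟨hx, ((h.isStep a i).isPos_iff h.reduced (h.rootBasis a) (h.rootBasis _) hx ?_
      ?_).1 hpos, hneg⟩
    · rintro rfl
      exact (h.isStep a i).not_isPos hpos
    · rintro rfl
      exact hneg (((h.rootBasis a₀).isPos_neg_iff h.reduced hmem).2 hi)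
  · exact (h.isStep a i).not_isPos (hs ⟨hmem, isPos_basis _ i, hi⟩).2.1

/-- If both directions at `a` are descents, all positive plane roots at `a` are inversions, so `a`
is the top of its rank two loop: signs outside the plane do not change along the loop, and strictly
inside it some plane root is flipped. -/
theorem ncard_inversions_alternatingWalk_lt (h : S.Realizes R β) {a₀ a : S.A} {i j : S.I}
    (hij : i ≠ j) (hi : IsPos (β a₀) (-β a i)) (hj : IsPos (β a₀) (-β a j)) {n : ℕ} (hn₀ : 0 < n)
    (hn : n < 2 * (planeRoots R (β a) i j).ncard) :
    (S.inversions R β a₀ (S.alternatingWalk j i a n)).ncard <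
      (S.inversions R β a₀ a).ncard := by
  have hw := h.isAlternatingWalk a hij
  have hneg : ∀ y ∈ planeRoots R (β a) i j, IsPos (β a₀) (-y) := by
    rintro y ⟨hy, hpos, h0⟩
    refine isPos_neg_of_support hpos fun k hk => ?_
    by_cases hki : k = i
    · rwa [hki]
    by_cases hkj : k = j
    · rwa [hkj]
    exact absurd (h0 k hki hkj) hk
  refine Set.ncard_lt_ncard ⟨?_, fun hs => ?_⟩ (h.finite_inversions _ _)
  · rintro x ⟨hx, hpos, hx₀⟩
    refine ⟨hx, ?_, hx₀⟩
    by_cases hk : ∀ k, k ≠ i → k ≠ j → (β a).repr x k = 0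
    · refine ((h.rootBasis a).pos_or_neg x hx).resolve_right fun hnx => hx₀ ?_
      have := hneg (-x) ⟨h.reduced.neg_mem x hx, hnx, fun k hi hj => by simp [hk k hi hj]⟩
      rwa [neg_neg] at this
    · push Not at hk
      obtain ⟨k, hi, hj, hk⟩ := hk
      exact (hw.isPos_iff n hx hi hj hk).1 hpos
  · obtain ⟨y, hy, hyn⟩ := hw.flipped_nonempty h.reduced hn₀ hn
    refine hyn (hs ⟨hy.1, hy.2.1, ?_⟩).2.1
    exact ((h.rootBasis a₀).isPos_neg_iff h.reduced hy.1).1 (hneg y hy)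

/-- Only a descent `i` needs an argument. Let `j ≠ i` be the last ascending step, from `c` to `a`.
By (R4) the rank two loop at `a` closes, so `ρ_i a` is reached from `c` the other way around. All
intermediate objects have fewer inversions than `a`, and the induction hypothesis applies at each of
them. -/
theorem ascentReachable_ρ (h : S.Realizes R β) (hS : S.IsFiniteType) {a₀ : S.A} (n : ℕ) :
    ∀ a, (S.inversions R β a₀ a).ncard = n → S.AscentReachable β a₀ a →
      ∀ i, S.AscentReachable β a₀ (S.ρ i a) := by
  have : Nonempty S.A := ⟨a₀⟩
  induction n using Nat.strong_induction_on with
  | _ n ih =>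
    intro a ha hD i
    by_cases hi : IsPos (β a₀) (β a i)
    · exact .step a i hD hi
    have hin := ((h.rootBasis a₀).isPos_neg_iff h.reduced ((h.rootBasis a).mem i)).2 hi
    cases hD with
    | base => exact absurd (isPos_basis _ i) hi
    | step c j hc hj =>
      by_cases hij : i = j
      · rw [hij, hS.scheme.ρ_ρ]
        exact hc
      set a := S.ρ j c with hadef
      have hjn : IsPos (β a₀) (-β a j) := by
        rw [(h.isStep c j).1, neg_neg]
        exact hj
      set m := (planeRoots R (β a) i j).ncard with hm
      have hm0 : 0 < m := by
        rw [hm, Set.ncard_pos (IsAlternatingWalk.planeRoots_finite h.reduced _)]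
        refine ⟨β a i, (h.rootBasis a).mem i, isPos_basis _ i, fun k hk _ => ?_⟩
        simp [Ne.symm hk]
      have hwalk : ∀ k, k + 1 < 2 * m →
          S.AscentReachable β a₀ (S.alternatingWalk j i a (k + 1)) := by
        intro k
        induction k with
        | zero =>
          intro _
          have : S.alternatingWalk j i a (0 + 1) = c := hS.scheme.ρ_ρ j c
          rwa [this]
        | succ k ihk =>
          intro hk
          exact ih _ (ha ▸ h.ncard_inversions_alternatingWalk_lt hij hin hjn (Nat.succ_pos k)
            (by omega)) _ rfl (ihk (by omega)) _
      have hloop : S.alternatingWalk j i a (2 * m) = a := by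
        have := hS.rootSystem.R4 a i j hij ((hS.finite a).subset fun _ hx => hx.1)
        rwa [iterate_eq_alternatingWalk, h.ncard_plane hS.connected a hij] at this
      obtain ⟨k, hk⟩ : ∃ k, 2 * m = (k + 1) + 1 := ⟨2 * m - 2, by omega⟩
      have hodd : ¬Even (k + 1) := by
        intro he
        have h1 : Even (k + 1 + 1) := hk ▸ even_two_mul m
        rw [Nat.even_add_one] at h1
        exact h1 he
      -- The loop of length `2 * m` ends with a step in direction `i`, so its last object before `a`
      -- is `ρ_i a`.
      rw [hk, alternatingWalk, alternating, if_neg hodd] at hloop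
      rw [← hloop, hS.scheme.ρ_ρ]
      exact hwalk k (by omega)

/-- Realizations of schemes of finite type are injective. -/
theorem injective (h : S.Realizes R β) (hS : S.IsFiniteType) : Function.Injective β := by
  obtain ⟨a₀⟩ := hS.scheme.nonempty_A
  have hD : ∀ a, S.AscentReachable β a₀ a := by
    intro a
    obtain ⟨w, hw⟩ := hS.connected a₀ a
    induction hw with
    | id => exact .base
    | comp a w i _ ih => exact h.ascentReachable_ρ hS _ a rfl ih i
  -- If `a` is reached by a last ascent `j`, then `ρ_j` lowers the number of inversions and keeps
  -- the two bases equal. If `a` is `a₀`, then `a'` has no descents and is also `a₀`.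
  have key : ∀ n a a', (S.inversions R β a₀ a).ncard = n → β a = β a' → a = a' := by
    intro n
    induction n using Nat.strong_induction_on with
    | _ n ih =>
      intro a a' ha haa
      have hdesc : ∀ c j, IsPos (β a₀) (β c j) → ¬IsPos (β a₀) (β (S.ρ j c) j) := by
        intro c j hj
        rw [(h.isStep c j).1]
        exact not_isPos_neg ((β c).ne_zero j) hj
      cases hD a with
      | base =>
        cases hD a' with
        | base => rfl
        | step c j hc hj => exact absurd (haa ▸ isPos_basis _ j) (hdesc c j hj)
      | step c j hc hj =>
        have hlt := h.ncard_inversions_lt (hdesc c j hj)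
        have hs := h.isStep a' j
        rw [← haa] at hs
        have := ih _ (ha ▸ hlt) _ (S.ρ j a') rfl
          ((h.isStep _ j).unique (h.rootBasis _) (h.rootBasis _) hs)
        rw [← hS.scheme.ρ_ρ j a', ← this, hS.scheme.ρ_ρ]
  exact fun a a' haa => key _ a a' rfl haa

end Realizes

end CartanQuadruple

/-! ### Chambers and root bases -/

namespace Arrangement

open RootBasis

variable {r : ℕ} {ι : Type*} {R : Set (Dual ℝ (Fin r → ℝ))}

/-- The kernels of the elements of `R`. -/
def hyperplanes (R : Set (Dual ℝ (Fin r → ℝ))) : Set (Submodule ℝ (Fin r → ℝ)) :=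
  {H | ∃ α ∈ R, H = LinearMap.ker α}

theorem mem_complement_iff {v : Fin r → ℝ} :
    v ∈ complement (hyperplanes R) ↔ ∀ α ∈ R, α v ≠ 0 := by
  constructor
  · intro h α hα h0
    exact h _ ⟨α, hα, rfl⟩ h0
  · rintro h _ ⟨α, hα, rfl⟩ h0
    exact h α hα h0

theorem subset_complement {𝒜 : Set (Submodule ℝ (Fin r → ℝ))} {K : Set (Fin r → ℝ)}
    (hK : K ∈ chambers 𝒜) : K ⊆ complement 𝒜 := by
  obtain ⟨v, hv, rfl⟩ := hK
  exact connectedComponentIn_subset _ _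

theorem eq_connectedComponentIn {𝒜 : Set (Submodule ℝ (Fin r → ℝ))} {K : Set (Fin r → ℝ)}
    (hK : K ∈ chambers 𝒜) {v : Fin r → ℝ} (hv : v ∈ K) :
    K = connectedComponentIn (complement 𝒜) v := by
  obtain ⟨w, hw, rfl⟩ := hK
  exact connectedComponentIn_eq hv

theorem chambers_eq_of_mem {𝒜 : Set (Submodule ℝ (Fin r → ℝ))} {K K' : Set (Fin r → ℝ)}
    (hK : K ∈ chambers 𝒜) (hK' : K' ∈ chambers 𝒜) {v : Fin r → ℝ} (hv : v ∈ K) (hv' : v ∈ K') :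
    K = K' :=
  (eq_connectedComponentIn hK hv).trans (eq_connectedComponentIn hK' hv').symm

theorem nonempty_of_mem_chambers {𝒜 : Set (Submodule ℝ (Fin r → ℝ))} {K : Set (Fin r → ℝ)}
    (hK : K ∈ chambers 𝒜) : K.Nonempty := by
  obtain ⟨w, hw, rfl⟩ := hK
  exact ⟨w, mem_connectedComponentIn hw⟩

theorem pos_of_isPreconnected {K : Set (Fin r → ℝ)} (hK : IsPreconnected K)
    {α : Dual ℝ (Fin r → ℝ)} (hα : ∀ v ∈ K, α v ≠ 0) {u v : Fin r → ℝ} (hu : u ∈ K) (hv : v ∈ K)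
    (h : 0 < α u) : 0 < α v := by
  by_contra hn
  obtain ⟨w, hw, h0⟩ := hK.intermediate_value hv hu
    (LinearMap.continuous_of_finiteDimensional α).continuousOn ⟨not_lt.1 hn, h.le⟩
  exact hα w hw h0

/-- The open cone on which all members of `b` are positive. -/
def posCone (b : Basis ι ℝ (Dual ℝ (Fin r → ℝ))) : Set (Fin r → ℝ) := {v | ∀ i, 0 < b i v}

theorem posCone_eq_of_range {κ : Type*} {b : Basis ι ℝ (Dual ℝ (Fin r → ℝ))}
    {b' : Basis κ ℝ (Dual ℝ (Fin r → ℝ))} (h : Set.range b = Set.range b') :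
    posCone b = posCone b' := by
  ext v
  exact ⟨fun hv k => by
      obtain ⟨i, hi⟩ := h.symm.subset ⟨k, rfl⟩
      exact hi ▸ hv i,
    fun hv i => by
      obtain ⟨k, hk⟩ := h.subset ⟨i, rfl⟩
      exact hk ▸ hv k⟩

variable [Fintype ι]

theorem apply_eq_sum (b : Basis ι ℝ (Dual ℝ (Fin r → ℝ))) (x : Dual ℝ (Fin r → ℝ))
    (v : Fin r → ℝ) : x v = ∑ i, b.repr x i * b i v := by
  conv_lhs => rw [← b.sum_repr x]
  simp only [LinearMap.sum_apply, LinearMap.smul_apply, smul_eq_mul]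

theorem isPos_iff_of_mem_posCone {b : Basis ι ℝ (Dual ℝ (Fin r → ℝ))} (h0 : (0 : Dual ℝ _) ∉ R)
    (hs : ∀ x ∈ R, IsPos b x ∨ IsPos b (-x)) {v : Fin r → ℝ} (hv : v ∈ posCone b)
    {x : Dual ℝ (Fin r → ℝ)} (hx : x ∈ R) : (IsPos b x ↔ 0 < x v) ∧ x v ≠ 0 := by
  have key : ∀ y : Dual ℝ (Fin r → ℝ), y ≠ 0 → IsPos b y → 0 < y v := by
    intro y hy hpos
    rw [apply_eq_sum b y v]
    obtain ⟨j, hj⟩ : ∃ j, b.repr y j ≠ 0 := by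
      by_contra! H
      exact hy (b.repr.injective (Finsupp.ext fun j => by simpa using H j))
    exact Finset.sum_pos' (fun i _ => mul_nonneg (hpos i) (hv i).le)
      ⟨j, Finset.mem_univ j, mul_pos (lt_of_le_of_ne (hpos j) hj.symm) (hv j)⟩
  have hx0 : x ≠ 0 := fun h => h0 (h ▸ hx)
  rcases hs x hx with hp | hp
  · have := key x hx0 hp
    exact ⟨⟨fun _ => this, fun _ => hp⟩, this.ne'⟩
  · have := key (-x) (neg_ne_zero.2 hx0) hp
    rw [LinearMap.neg_apply] at this
    refine ⟨⟨fun h => key x hx0 h, fun h => ?_⟩, by linarith⟩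
    linarith

variable [DecidableEq ι]

/-- The basis of the space that is dual to a basis of the dual space. -/
def predual (b : Basis ι ℝ (Dual ℝ (Fin r → ℝ))) : Basis ι ℝ (Fin r → ℝ) :=
  b.dualBasis.map (evalEquiv ℝ (Fin r → ℝ)).symm

theorem apply_predual (b : Basis ι ℝ (Dual ℝ (Fin r → ℝ))) (i j : ι) :
    b i (predual b j) = if i = j then 1 else 0 := by
  rw [predual, Basis.map_apply, apply_evalEquiv_symm_apply, Basis.dualBasis_apply_self]

theorem predual_repr (b : Basis ι ℝ (Dual ℝ (Fin r → ℝ))) (v : Fin r → ℝ) (i : ι) :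
    (predual b).repr v i = b i v := by
  conv_rhs => rw [← (predual b).sum_repr v, map_sum]
  simp [apply_predual, -Basis.sum_repr]

theorem sum_smul_predual (b : Basis ι ℝ (Dual ℝ (Fin r → ℝ))) (v : Fin r → ℝ) :
    ∑ i, b i v • predual b i = v := by
  simpa only [predual_repr] using (predual b).sum_repr v

theorem repr_eq_apply_predual (b : Basis ι ℝ (Dual ℝ (Fin r → ℝ))) (x : Dual ℝ (Fin r → ℝ))
    (i : ι) : b.repr x i = x (predual b i) := by
  rw [apply_eq_sum b x]
  simp [apply_predual]

theorem sum_predual_mem (b : Basis ι ℝ (Dual ℝ (Fin r → ℝ))) : ∑ j, predual b j ∈ posCone b := by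
  intro i
  simp [apply_predual]

theorem isOpenSimplicialCone_posCone (b : Basis ι ℝ (Dual ℝ (Fin r → ℝ))) :
    IsOpenSimplicialCone (posCone b) := by
  have hc : Fintype.card ι = r := by
    rw [← finrank_eq_card_basis (predual b), finrank_fin_fun]
  let e : ι ≃ Fin r := Fintype.equivFinOfCardEq hc
  refine ⟨(predual b).reindex e, Set.ext fun v => ⟨fun hv => ⟨fun k => b (e.symm k) v,
    fun k => hv _, ?_⟩, ?_⟩⟩
  · conv_lhs => rw [← sum_smul_predual b v]
    rw [← e.symm.sum_comp]
    simp
  · rintro ⟨a, ha, rfl⟩ i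
    rw [← e.sum_comp]
    simpa [apply_predual] using ha (e i)

theorem posCone_mem_chambers {b : Basis ι ℝ (Dual ℝ (Fin r → ℝ))} (h0 : (0 : Dual ℝ _) ∉ R)
    (hmem : ∀ i, b i ∈ R) (hs : ∀ x ∈ R, IsPos b x ∨ IsPos b (-x)) :
    posCone b ∈ chambers (hyperplanes R) := by
  have hsub : posCone b ⊆ complement (hyperplanes R) := fun v hv =>
    mem_complement_iff.2 fun x hx => (isPos_iff_of_mem_posCone h0 hs hv hx).2
  have hp := sum_predual_mem b
  refine ⟨_, hsub hp, Set.Subset.antisymm ?_ fun v hv i => ?_⟩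
  · refine IsPreconnected.subset_connectedComponentIn (Convex.isPreconnected ?_) hp hsub
    intro u hu v hv s t hs ht hst i
    rw [map_add, map_smul, map_smul, smul_eq_mul, smul_eq_mul]
    rcases hs.eq_or_lt with rfl | hs
    · have : t = 1 := by linarith
      simpa [this] using hv i
    · exact add_pos_of_pos_of_nonneg (mul_pos hs (hu i)) (mul_nonneg ht (hv i).le)
  · refine pos_of_isPreconnected isPreconnected_connectedComponentIn (fun w hw => ?_)
      (mem_connectedComponentIn (hsub hp)) hv (hp i)
    exact mem_complement_iff.1 (connectedComponentIn_subset _ _ hw) _ (hmem i)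

theorem closure_posCone (b : Basis ι ℝ (Dual ℝ (Fin r → ℝ))) :
    closure (posCone b) = {v | ∀ i, 0 ≤ b i v} := by
  apply Set.Subset.antisymm
  · refine closure_minimal (fun v hv i => (hv i).le) ?_
    rw [Set.ofPred_forall]
    exact isClosed_iInter fun i =>
      isClosed_le continuous_const (LinearMap.continuous_of_finiteDimensional (b i))
  · intro v hv
    have ht : Filter.Tendsto (fun t : ℝ => v + t • ∑ j, predual b j) (nhdsWithin 0 (Set.Ioi 0))
        (nhds v) := by
      have : Continuous fun t : ℝ => v + t • ∑ j, predual b j := by fun_prop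
      have := (this.tendsto 0).mono_left (nhdsWithin_le_nhds (s := Set.Ioi 0))
      simpa using this
    refine mem_closure_of_tendsto ht ?_
    filter_upwards [self_mem_nhdsWithin] with t ht i
    rw [map_add, map_smul]
    exact add_pos_of_nonneg_of_pos (hv i) (mul_pos ht (sum_predual_mem b i))

theorem predual_mem_closure (b : Basis ι ℝ (Dual ℝ (Fin r → ℝ))) (j : ι) :
    predual b j ∈ closure (posCone b) := by
  rw [closure_posCone]
  intro i
  rw [apply_predual]
  split_ifs <;> norm_num

/-- A set in a hyperplane `ker (b i)` that contains the dual basis vectors spans it. -/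
theorem span_eq_ker {b : Basis ι ℝ (Dual ℝ (Fin r → ℝ))} {i : ι} {s : Set (Fin r → ℝ)}
    (hs : ∀ v ∈ s, b i v = 0) (hb : ∀ j, j ≠ i → predual b j ∈ s) :
    Submodule.span ℝ s = LinearMap.ker (b i) := by
  apply le_antisymm
  · exact Submodule.span_le.2 hs
  · intro v hv
    rw [← sum_smul_predual b v]
    refine Submodule.sum_mem _ fun j _ => ?_
    by_cases hj : j = i
    · rw [hj, show b i v = 0 from hv, zero_smul]
      exact Submodule.zero_mem _
    · exact Submodule.smul_mem _ _ (Submodule.subset_span (hb j hj))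

theorem finrank_ker_add_one {x : Dual ℝ (Fin r → ℝ)} (hx : x ≠ 0) :
    finrank ℝ (LinearMap.ker x) + 1 = r := by
  rw [Dual.finrank_ker_add_one_of_ne_zero hx, finrank_fin_fun]

/-- A positive root outside `b` has two positive coordinates `j`, `k`. Where it vanishes on the
closed cone, both `b j` and `b k` vanish, so it cuts out a face of codimension at least two and is
not a wall. -/
theorem base_posCone (hR : IsReducedSet R) {b : Basis ι ℝ (Dual ℝ (Fin r → ℝ))}
    (hmem : ∀ i, b i ∈ R) (hs : ∀ x ∈ R, IsPos b x ∨ IsPos b (-x)) :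
    base (hyperplanes R) R (posCone b) = Set.range b := by
  have h0 : (0 : Dual ℝ _) ∉ R := fun h => hR.ne_zero h rfl
  ext x
  constructor
  · rintro ⟨hx, ⟨-, hrank⟩, hnn⟩
    by_contra hne
    have hne : ∀ i, x ≠ b i := fun i hi => hne ⟨i, hi.symm⟩
    have hp := sum_predual_mem b
    have hpos : IsPos b x := (isPos_iff_of_mem_posCone h0 hs hp hx).1.2
      (lt_of_le_of_ne (hnn _ hp) (isPos_iff_of_mem_posCone h0 hs hp hx).2.symm)
    obtain ⟨j, hj⟩ := exists_repr_pos' hR hx hpos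
    obtain ⟨k, hkj, hk⟩ := exists_repr_pos hR (hmem j) hx hpos (hne j)
    have hle : Submodule.span ℝ ((LinearMap.ker x : Set (Fin r → ℝ)) ∩ closure (posCone b)) ≤
        LinearMap.ker (b j) ⊓ LinearMap.ker (b k) := by
      rw [Submodule.span_le]
      rintro v ⟨hv, hvc⟩
      rw [closure_posCone] at hvc
      have hv : x v = 0 := hv
      rw [apply_eq_sum b x v] at hv
      have := (Finset.sum_eq_zero_iff_of_nonneg fun i _ => mul_nonneg (hpos i) (hvc i)).1 hv
      exact ⟨(mul_eq_zero.1 (this j (Finset.mem_univ j))).resolve_left hj.ne',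
        (mul_eq_zero.1 (this k (Finset.mem_univ k))).resolve_left hk.ne'⟩
    have hlt : LinearMap.ker (b j) ⊓ LinearMap.ker (b k) < LinearMap.ker (b j) := by
      refine lt_of_le_of_ne inf_le_left fun h => ?_
      have h₁ : predual b k ∈ LinearMap.ker (b j) := by
        rw [LinearMap.mem_ker, apply_predual, if_neg hkj.symm]
      rw [← h] at h₁
      have := h₁.2
      simp [apply_predual] at this
    have h₁ := (Submodule.finrank_mono hle).trans_lt (Submodule.finrank_lt_finrank_of_lt hlt)
    have h₂ := finrank_ker_add_one (b.ne_zero j)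
    omega
  · rintro ⟨i, rfl⟩
    refine ⟨hmem i, ⟨⟨b i, hmem i, rfl⟩, ?_⟩, fun v hv => (hv i).le⟩
    have hspan : Submodule.span ℝ ((LinearMap.ker (b i) : Set (Fin r → ℝ)) ∩
        closure (posCone b)) = LinearMap.ker (b i) :=
      span_eq_ker (fun v hv => hv.1) fun j hj =>
        ⟨by simp [apply_predual, hj.symm], predual_mem_closure b j⟩
    rw [hspan]
    exact finrank_ker_add_one (b.ne_zero i)

/-- A real vector space is not a finite union of proper subspaces. -/
theorem complement_nonempty (hfin : R.Finite) (h0 : (0 : Dual ℝ _) ∉ R) :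
    (complement (hyperplanes R)).Nonempty := by
  classical
  have htop : (⊤ : Submodule ℝ (Fin r → ℝ)) ∉ hfin.toFinset.image LinearMap.ker := by
    intro h
    simp only [Finset.mem_image, Set.Finite.mem_toFinset, LinearMap.ker_eq_top] at h
    obtain ⟨x, hx, rfl⟩ := h
    exact h0 hx
  have := Subspace.biUnion_ne_univ_of_top_notMem htop
  obtain ⟨v, hv⟩ := (Set.ne_univ_iff_exists_notMem _).1 this
  refine ⟨v, mem_complement_iff.2 fun x hx hxv => hv ?_⟩
  simp only [Set.mem_iUnion]
  exact ⟨LinearMap.ker x, by simpa using ⟨x, hx, rfl⟩, hxv⟩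

/-- The walls of a chamber that is a simplicial cone are given by a basis consisting of roots. -/
theorem exists_basis_of_isOpenSimplicialCone (hneg : ∀ x ∈ R, -x ∈ R) (h0 : (0 : Dual ℝ _) ∉ R)
    {K : Set (Fin r → ℝ)} (hK : K ∈ chambers (hyperplanes R)) (hcone : IsOpenSimplicialCone K) :
    ∃ b : Basis (Fin r) ℝ (Dual ℝ (Fin r → ℝ)), (∀ i, b i ∈ R) ∧
      (∀ x ∈ R, IsPos b x ∨ IsPos b (-x)) ∧ K = posCone b := by
  obtain ⟨e, he⟩ := hcone
  have hmemK : ∀ a : Fin r → ℝ, (∀ i, 0 < a i) → ∑ i, a i • e i ∈ K := fun a ha => by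
    rw [he]
    exact ⟨a, ha, rfl⟩
  have hone : ∑ i, e i ∈ K := by simpa using hmemK 1 fun _ => zero_lt_one
  have hne : ∀ x ∈ R, ∀ v ∈ K, x v ≠ 0 := fun x hx v hv =>
    mem_complement_iff.1 (subset_complement hK hv) x hx
  have hsign : ∀ x ∈ R, 0 < x (∑ i, e i) → ∀ j, 0 ≤ x (e j) := by
    intro x hx hpos j
    by_contra! hj
    -- The parameter at which the ray from `∑ i, e i` in direction `e j`, which stays in `K`, would
    -- meet the kernel of `x`.
    set t := x (∑ i, e i) / -x (e j) with ht
    have ht0 : 0 < t := div_pos hpos (by linarith)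
    have hmem : ∑ i, e i + t • e j ∈ K := by
      have := hmemK (fun i => 1 + if i = j then t else 0) fun i => by split_ifs <;> linarith
      simpa [add_smul, Finset.sum_add_distrib] using this
    refine hne x hx _ hmem ?_
    rw [map_add, map_smul, smul_eq_mul, ht, div_neg, neg_mul, div_mul_cancel₀ _ hj.ne, add_neg_cancel]
  have hsign' : ∀ x ∈ R, (∀ j, 0 ≤ x (e j)) ∨ ∀ j, 0 ≤ (-x) (e j) := by
    intro x hx
    rcases lt_or_gt_of_ne (hne x hx _ hone) with h | h
    · exact Or.inr (hsign _ (hneg x hx) (by simpa using h))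
    · exact Or.inl (hsign x hx h)
  have hex : ∀ i, ∃ x ∈ R, 0 < x (e i) ∧ ∀ j, j ≠ i → x (e j) = 0 := by
    intro i
    -- An interior point of the facet opposite to `e i`. It is not in `K`, but a segment inside `K`
    -- leads up to it, so it lies on some hyperplane; a root of constant sign vanishing at `p`
    -- vanishes at every `e j` with `j ≠ i`.
    set p := ∑ j ∈ Finset.univ.erase i, e j with hp
    have hsum : ∑ j, e j = e i + p := (Finset.add_sum_erase _ _ (Finset.mem_univ i)).symm
    have hpK : p ∉ K := by
      rw [he]
      rintro ⟨a, ha, hpa⟩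
      have := congrArg (fun v => e.repr v i) hpa
      simp only [hp, map_sum, map_smul, Basis.repr_self, Finsupp.coe_finsetSum,
        Finset.sum_apply, Finsupp.smul_apply, Finsupp.single_apply, smul_eq_mul] at this
      rw [Finset.sum_eq_zero fun j hj => if_neg (Finset.ne_of_mem_erase hj)] at this
      simp at this
      exact (ha i).ne this
    have hpc : p ∉ complement (hyperplanes R) := by
      intro hpc
      refine hpK ?_
      rw [eq_connectedComponentIn hK hone]
      refine (convex_segment (𝕜 := ℝ) (∑ j, e j) p).isPreconnected.subset_connectedComponentIn
        (left_mem_segment _ _ _) ?_ (right_mem_segment _ _ _)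
      rintro _ ⟨s, t, hs, ht, hst, rfl⟩
      rcases hs.eq_or_lt with rfl | hs
      · have : t = 1 := by linarith
        simpa [this] using hpc
      · refine subset_complement hK ?_
        have := hmemK (fun j => if j = i then s else 1) fun j => by split_ifs <;> linarith
        rw [← Finset.add_sum_erase _ _ (Finset.mem_univ i)] at this
        rw [Finset.sum_congr rfl (g := fun j => e j) fun j hj => by
          simp [Finset.ne_of_mem_erase hj]] at this
        convert this using 1
        rw [if_pos rfl, hsum, ← hp, smul_add, add_assoc, ← add_smul, hst, one_smul]
    rw [mem_complement_iff] at hpc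
    push Not at hpc
    obtain ⟨x, hx, hxp⟩ := hpc
    have main : ∀ y ∈ R, y p = 0 → (∀ j, 0 ≤ y (e j)) →
        ∃ x ∈ R, 0 < x (e i) ∧ ∀ j, j ≠ i → x (e j) = 0 := by
      intro y hy hyp hnn
      rw [hp, map_sum, Finset.sum_eq_zero_iff_of_nonneg fun j _ => hnn j] at hyp
      have hz : ∀ j, j ≠ i → y (e j) = 0 := fun j hj => hyp j (by simp [hj])
      refine ⟨y, hy, lt_of_le_of_ne (hnn i) fun h => h0 ?_, hz⟩
      have : y = 0 := e.ext fun j => by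
        by_cases hj : j = i
        · rw [hj, ← h, LinearMap.zero_apply]
        · rw [hz j hj, LinearMap.zero_apply]
      exact this ▸ hy
    rcases hsign' x hx with h | h
    · exact main x hx hxp h
    · exact main (-x) (hneg x hx) (by simp [hxp]) h
  choose x hxR hxpos hxz using hex
  let b := e.dualBasis.isUnitSMul (w := fun i => x i (e i)) fun i => (hxpos i).ne'.isUnit
  have hb : ∀ i, b i = x i := fun i => by
    rw [Basis.isUnitSMul_apply]
    refine e.ext fun j => ?_
    rw [LinearMap.smul_apply, Basis.dualBasis_apply_self]
    by_cases hj : j = i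
    · simp [hj]
    · simp [hj, hxz i j hj]
  have hrepr : ∀ y j, y (e j) = b.repr y j * x j (e j) := by
    intro y j
    rw [apply_eq_sum b y, Finset.sum_eq_single j, hb]
    · intro i _ hij
      rw [hb, hxz i j hij.symm, mul_zero]
    · simp
  have hpos : ∀ y : Dual ℝ (Fin r → ℝ), (∀ j, 0 ≤ y (e j)) → IsPos b y := by
    intro y hy j
    have := hy j
    rw [hrepr] at this
    exact nonneg_of_mul_nonneg_left this (hxpos j)
  refine ⟨b, fun i => hb i ▸ hxR i, fun y hy => (hsign' y hy).imp (hpos y) (hpos (-y)), ?_⟩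
  have happ : ∀ (a : Fin r → ℝ) i, b i (∑ j, a j • e j) = a i * x i (e i) := by
    intro a i
    rw [map_sum, Finset.sum_eq_single i, hb, map_smul, smul_eq_mul]
    · intro j _ hj
      rw [hb, map_smul, hxz i j hj, smul_zero]
    · simp
  rw [he]
  ext v
  constructor
  · rintro ⟨a, ha, rfl⟩ i
    rw [happ]
    exact mul_pos (ha i) (hxpos i)
  · intro hv
    refine ⟨e.repr v, fun i => ?_, (e.sum_repr v).symm⟩
    have := hv i
    rw [← e.sum_repr v, happ] at this
    exact pos_of_mul_pos_left this (hxpos i).le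

end Arrangement

/-! ### The scheme of a crystallographic arrangement is realized by its roots -/

theorem RootBasis.IsRootBasis.of_range_eq {W : Type*} [AddCommGroup W] [Module ℝ W] {ι κ : Type*}
    {R : Set W} {b : Basis ι ℝ W} {b' : Basis κ ℝ W} (hb : RootBasis.IsRootBasis R b)
    (h : Set.range b = Set.range b') : RootBasis.IsRootBasis R b' := by
  let e : ι ≃ κ := (Equiv.ofInjective b b.injective).trans
    ((Equiv.setCongr h).trans (Equiv.ofInjective b' b'.injective).symm)
  have he : ∀ i, b' (e i) = b i := fun i => by
    have := Equiv.apply_ofInjective_symm b'.injective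
      ((Equiv.setCongr h) (Equiv.ofInjective b b.injective i))
    exact this
  have : b' = b.reindex e := Basis.eq_of_apply_eq fun k => by
    rw [Basis.reindex_apply, ← he, e.apply_symm_apply]
  rw [this]
  exact hb.reindex e

theorem basisReflection_apply {r : ℕ} {W : Type*} [AddCommGroup W] [Module ℝ W]
    (b : Basis (Fin r) ℝ W) (i : Fin r) (c : Fin r → ℕ) (j : Fin r) :
    basisReflection b i c (b j) = if j = i then -b i else b j + c j • b i :=
  b.constr_basis ℝ _ j

theorem isStep_basisReflection {r : ℕ} {W : Type*} [AddCommGroup W] [Module ℝ W]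
    (b : Basis (Fin r) ℝ W) (i : Fin r) (c : Fin r → ℕ) :
    RootBasis.IsStep b i (b.map (basisReflection b i c)) := by
  refine ⟨?_, fun j hj => ⟨c j, ?_⟩⟩
  · rw [Basis.map_apply, basisReflection_apply, if_pos rfl]
  · rw [Basis.map_apply, basisReflection_apply, if_neg hj, Nat.cast_smul_eq_nsmul]

namespace CrystallographicArrangement

open RootBasis Arrangement

variable (X : CrystallographicArrangement)

theorem 𝒜_eq_hyperplanes : X.𝒜 = hyperplanes X.R := X.𝒜_eq

theorem isReducedSet : IsReducedSet X.R where
  finite := X.finite_R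
  neg_mem x hx := by
    have : -x ∈ ({x, -x} : Set _) := by simp
    rw [← X.reduced x hx] at this
    exact this.1
  reduced x hx t ht := by
    have hx0 : x ≠ 0 := by
      rintro rfl
      have := X.simplicial.hyperplane (LinearMap.ker (0 : Dual ℝ (Fin X.r → ℝ)))
        (by rw [X.𝒜_eq]; exact ⟨0, hx, rfl⟩)
      rw [LinearMap.ker_zero, finrank_top, finrank_fin_fun] at this
      omega
    have : t • x ∈ ({x, -x} : Set _) := by
      rw [← X.reduced x hx]
      exact ⟨ht, t, rfl⟩
    rcases this with h | h
    · left
      refine smul_left_injective ℝ hx0 ?_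
      simpa using h
    · right
      refine smul_left_injective ℝ hx0 ?_
      simpa using h

theorem zero_notMem : (0 : Dual ℝ (Fin X.r → ℝ)) ∉ X.R := fun h => X.isReducedSet.ne_zero h rfl

theorem nonempty_chambers : (chambers X.𝒜).Nonempty := by
  obtain ⟨v, hv⟩ := complement_nonempty X.finite_R X.zero_notMem
  rw [X.𝒜_eq_hyperplanes]
  exact ⟨_, v, hv, rfl⟩

variable {X}

theorem base_posCone {b : Basis (Fin X.r) ℝ (Dual ℝ (Fin X.r → ℝ))} (hb : IsRootBasis X.R b) :
    base X.𝒜 X.R (posCone b) = Set.range b := by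
  rw [X.𝒜_eq_hyperplanes]
  exact Arrangement.base_posCone X.isReducedSet hb.mem hb.pos_or_neg

theorem posCone_mem_chambers {b : Basis (Fin X.r) ℝ (Dual ℝ (Fin X.r → ℝ))}
    (hb : IsRootBasis X.R b) : posCone b ∈ chambers X.𝒜 := by
  rw [X.𝒜_eq_hyperplanes]
  exact Arrangement.posCone_mem_chambers X.zero_notMem hb.mem hb.pos_or_neg

theorem exists_rootBasis {K : Set (Fin X.r → ℝ)} (hK : K ∈ chambers X.𝒜) :
    ∃ b : Basis (Fin X.r) ℝ (Dual ℝ (Fin X.r → ℝ)), IsRootBasis X.R b ∧ K = posCone b := by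
  have hcone := X.simplicial.cone K hK
  have hint := X.integral K hK
  rw [X.𝒜_eq_hyperplanes] at hK hint
  obtain ⟨b, hmem, hs, rfl⟩ := exists_basis_of_isOpenSimplicialCone X.isReducedSet.neg_mem
    X.zero_notMem hK hcone
  refine ⟨b, ⟨hmem, fun x hx i => ?_, hs⟩, rfl⟩
  rw [Arrangement.base_posCone X.isReducedSet hmem hs] at hint
  obtain ⟨n, hn⟩ := (b.mem_span_iff_repr_mem ℤ x).1 (hint hx) i
  exact ⟨n, by rw [← hn]; rfl⟩

theorem isRootBasis_of_isOrdering {K : Set (Fin X.r → ℝ)} (hK : K ∈ chambers X.𝒜)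
    {α : Basis (Fin X.r) ℝ (Dual ℝ (Fin X.r → ℝ))} (hα : X.IsOrdering K α) :
    IsRootBasis X.R α ∧ K = posCone α := by
  obtain ⟨b, hb, rfl⟩ := exists_rootBasis hK
  have hr : Set.range b = Set.range α := by rw [hα, base_posCone hb]
  exact ⟨hb.of_range_eq hr, posCone_eq_of_range hr⟩

/-- For every root basis `b` and every index `i` there is a root basis related to `b` by a step in
direction `i`. -/
theorem exists_step {b : Basis (Fin X.r) ℝ (Dual ℝ (Fin X.r → ℝ))} (hb : IsRootBasis X.R b)
    (i : Fin X.r) : ∃ c : Fin X.r → ℕ, IsRootBasis X.R (b.map (basisReflection b i c)) := by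
  have hR := X.isReducedSet
  obtain ⟨M, hM⟩ := (X.finite_R.image fun x => x (predual b i)).bddAbove
  have hM : ∀ x ∈ X.R, x (predual b i) ≤ M := fun x hx => hM ⟨x, hx, rfl⟩
  have hM1 : 1 ≤ M := by simpa [apply_predual] using hM _ (hb.mem i)
  -- A point just across the wall. A positive root other than `b i` is at least `1` on the first sum
  -- by integrality, and the bound `M` limits the loss from the second term to `1 / 2`.
  set q := ∑ j ∈ Finset.univ.erase i, predual b j - (1 / (2 * M)) • predual b i with hq
  have hqi : b i q < 0 := by
    have h0 : ∑ j ∈ Finset.univ.erase i, b i (predual b j) = 0 :=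
      Finset.sum_eq_zero fun j hj => by
        rw [apply_predual, if_neg (Finset.ne_of_mem_erase hj).symm]
    rw [hq, map_sub, map_sum, h0, map_smul, apply_predual, if_pos rfl]
    have : 0 < 1 / (2 * M) := by positivity
    simpa using this
  have hqpos : ∀ x ∈ X.R, IsPos b x → x ≠ b i → 0 < x q := by
    intro x hx hpos hne
    obtain ⟨j, hj, hlt⟩ := exists_repr_pos hR (hb.mem i) hx hpos hne
    have h1 : 1 ≤ ∑ j ∈ Finset.univ.erase i, x (predual b j) := by
      have := hb.one_le_repr hx hpos hlt.ne'
      rw [repr_eq_apply_predual] at this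
      refine this.trans (Finset.single_le_sum (f := fun j => x (predual b j)) (fun k _ => ?_)
        (by simp [hj]))
      rw [← repr_eq_apply_predual]
      exact hpos k
    have h2 : 1 / (2 * M) * x (predual b i) ≤ 1 / 2 := by
      calc 1 / (2 * M) * x (predual b i) ≤ 1 / (2 * M) * M := by
            gcongr
            exact hM x hx
        _ = 1 / 2 := by field_simp
    rw [hq, map_sub, map_sum, map_smul, smul_eq_mul]
    linarith
  have hqc : q ∈ complement X.𝒜 := by
    rw [X.𝒜_eq_hyperplanes, mem_complement_iff]
    intro x hx
    by_cases h₁ : x = b i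
    · rw [h₁]
      exact hqi.ne
    by_cases h₂ : x = -b i
    · rw [h₂, LinearMap.neg_apply]
      linarith
    rcases hb.pos_or_neg x hx with h | h
    · exact (hqpos x hx h h₁).ne'
    · have := hqpos (-x) (hR.neg_mem x hx) h fun h => h₂ (by rw [← h, neg_neg])
      rw [LinearMap.neg_apply] at this
      linarith
  have hK : connectedComponentIn (complement X.𝒜) q ∈ chambers X.𝒜 := ⟨q, hqc, rfl⟩
  obtain ⟨b', hb', hKb'⟩ := exists_rootBasis hK
  have hqb' : q ∈ posCone b' := hKb' ▸ mem_connectedComponentIn hqc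
  have hiff : ∀ x ∈ X.R, IsPos b' x ↔ 0 < x q := fun x hx =>
    (isPos_iff_of_mem_posCone X.zero_notMem hb'.pos_or_neg hqb' hx).1
  obtain ⟨e, c, hei, hej⟩ := exists_equiv_of_isPos_iff hR hb hb' i
    (fun x hx hne hpos => (hiff x hx).2 (hqpos x hx hpos hne))
    (fun h => absurd ((hiff _ (hb.mem i)).1 h) (not_lt.2 hqi.le))
  refine ⟨c, ?_⟩
  have : b.map (basisReflection b i c) = b'.reindex e.symm := Basis.eq_of_apply_eq fun j => by
    rw [Basis.map_apply, basisReflection_apply, Basis.reindex_apply, Equiv.symm_symm]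
    split_ifs with hj
    · rw [hj, hei]
    · rw [hej j hj]
  rw [this]
  exact hb'.reindex _

theorem adjacent_of_isStep {b b' : Basis (Fin X.r) ℝ (Dual ℝ (Fin X.r → ℝ))}
    (hb : IsRootBasis X.R b) (hb' : IsRootBasis X.R b') {i : Fin X.r} (h : IsStep b i b') :
    Adjacent X.𝒜 (LinearMap.ker (b i)) (posCone b) (posCone b') := by
  refine ⟨posCone_mem_chambers hb, posCone_mem_chambers hb', fun heq => ?_, ?_⟩
  · have h₁ := sum_predual_mem b
    have h₂ := (heq ▸ h₁ : _ ∈ posCone b') i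
    rw [h.1, LinearMap.neg_apply] at h₂
    linarith [h₁ i]
  · refine span_eq_ker (fun v hv => ?_) fun j hj => ⟨predual_mem_closure b j, ?_⟩
    · rw [closure_posCone, closure_posCone] at hv
      have h₁ := hv.1 i
      have h₂ := hv.2 i
      rw [h.1, LinearMap.neg_apply] at h₂
      linarith
    · rw [closure_posCone]
      intro k
      by_cases hk : k = i
      · rw [hk, h.1, LinearMap.neg_apply, apply_predual, if_neg hj.symm, neg_zero]
      · obtain ⟨c, hc⟩ := h.2 k hk
        rw [hc, LinearMap.add_apply, LinearMap.smul_apply, apply_predual, apply_predual,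
          if_neg hj.symm, smul_zero, add_zero]
        split_ifs <;> norm_num

/-- Uniqueness of the adjacent chamber. A root positive on one chamber and negative on the other
vanishes on their common facet, hence on `ker (b i)`, which leaves only `b i`; so any adjacent
chamber lies on the same side of all hyperplanes as the cone of `b'`. -/
theorem nextChamber_posCone {b b' : Basis (Fin X.r) ℝ (Dual ℝ (Fin X.r → ℝ))}
    (hb : IsRootBasis X.R b) (hb' : IsRootBasis X.R b') {i : Fin X.r} (h : IsStep b i b') :
    X.nextChamber (posCone b) (LinearMap.ker (b i)) = posCone b' := by
  have hR := X.isReducedSet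
  obtain ⟨-, hK, hne, hspan⟩ : Adjacent X.𝒜 (LinearMap.ker (b i)) (posCone b)
      (X.nextChamber (posCone b) (LinearMap.ker (b i))) :=
    Classical.epsilon_spec ⟨_, adjacent_of_isStep hb hb' h⟩
  obtain ⟨b'', hb'', hKb⟩ := exists_rootBasis hK
  rw [hKb] at hK hne hspan ⊢
  have hp := sum_predual_mem b''
  set p := ∑ j, predual b'' j
  have hsign : ∀ x ∈ X.R, IsPos b'' x ↔ 0 < x p := fun x hx =>
    (isPos_iff_of_mem_posCone X.zero_notMem hb''.pos_or_neg hp hx).1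
  have hpos : ∀ x ∈ X.R, IsPos b x → x ≠ b i → 0 < x p := by
    intro x hx hx' hxi
    rw [← hsign x hx]
    obtain ⟨j, hj, hlt⟩ := exists_repr_pos hR (hb.mem i) hx hx' hxi
    refine (hb''.pos_or_neg x hx).resolve_right fun hn => ?_
    have hle : LinearMap.ker (b i) ≤ LinearMap.ker x := by
      rw [← hspan, Submodule.span_le]
      rintro v ⟨hv, hv'⟩
      rw [closure_posCone] at hv hv'
      have h₁ : 0 ≤ x v := by
        rw [apply_eq_sum b x v]
        exact Finset.sum_nonneg fun k _ => mul_nonneg (hx' k) (hv k)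
      have h₂ : 0 ≤ (-x) v := by
        rw [apply_eq_sum b'' (-x) v]
        exact Finset.sum_nonneg fun k _ => mul_nonneg (hn k) (hv' k)
      rw [LinearMap.neg_apply] at h₂
      exact le_antisymm (by linarith) h₁
    have : predual b j ∈ LinearMap.ker (b i) := by
      rw [LinearMap.mem_ker, apply_predual, if_neg hj.symm]
    have hxj : x (predual b j) = 0 := hle this
    rw [← repr_eq_apply_predual] at hxj
    exact hlt.ne' hxj
  have hi : b i p < 0 := by
    have h0 := (isPos_iff_of_mem_posCone X.zero_notMem hb''.pos_or_neg hp (hb.mem i)).2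
    refine lt_of_le_of_ne (not_lt.1 fun hi => hne ?_) h0
    refine chambers_eq_of_mem (posCone_mem_chambers hb) hK (v := p) (fun j => ?_) hp
    by_cases hj : j = i
    · rwa [hj]
    · exact hpos _ (hb.mem j) (isPos_basis b j) fun h => hj (b.injective h)
  refine chambers_eq_of_mem hK (posCone_mem_chambers hb') hp fun j => ?_
  by_cases hj : j = i
  · rw [hj, h.1, LinearMap.neg_apply]
    linarith
  · have h₁ : b' j ≠ b i := by
      intro he
      refine h.not_isPos ?_
      rw [← he]
      exact isPos_basis b' j
    have h₂ : b' j ≠ -b i := by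
      rw [← h.1]
      exact fun he => hj (b'.injective he)
    exact hpos _ (hb'.mem j)
      ((h.isPos_iff hR hb hb' (hb'.mem j) h₁ h₂).1 (isPos_basis b' j)) h₁

/-- Whatever coefficients are chosen, their defining property makes the new basis an ordering of the
base of the next chamber. The undetermined entry at `i` does not enter `basisReflection`. -/
theorem isRootBasis_coeff {b : Basis (Fin X.r) ℝ (Dual ℝ (Fin X.r → ℝ))} (hb : IsRootBasis X.R b)
    (i : Fin X.r) :
    IsRootBasis X.R (b.map (basisReflection b i (X.coeff (posCone b) b i))) := by
  obtain ⟨c, hc⟩ := exists_step hb i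
  have hbase : base X.𝒜 X.R (X.nextChamber (posCone b) (LinearMap.ker (b i))) =
      Set.range (b.map (basisReflection b i c)) := by
    rw [nextChamber_posCone hb hc (isStep_basisReflection b i c), base_posCone hc]
  have hrange : ∀ d, Set.range (b.map (basisReflection b i d)) =
      basisReflection b i d '' Set.range b := fun d => by
    rw [← Set.range_comp]
    rfl
  have hspec : Set.BijOn (basisReflection b i (X.coeff (posCone b) b i)) (Set.range b)
      (base X.𝒜 X.R (X.nextChamber (posCone b) (LinearMap.ker (b i)))) := by
    refine Classical.epsilon_spec (p := fun c => Set.BijOn (basisReflection b i c) (Set.range b)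
      (base X.𝒜 X.R (X.nextChamber (posCone b) (LinearMap.ker (b i))))) ⟨c, ?_⟩
    rw [hbase, hrange]
    exact (basisReflection b i c).injective.injOn.bijOn_image
  refine hc.of_range_eq ?_
  rw [← hbase, hrange, hspec.image_eq]

/-! ### Walks through the chambers and the realization by their bases -/

theorem walk_append (K : Set (Fin X.r → ℝ)) (α : Basis (Fin X.r) ℝ (Dual ℝ (Fin X.r → ℝ)))
    (a : List (Fin X.r)) (i : Fin X.r) : X.walk K α (a ++ [i]) = X.step α (X.walk K α a) i := by
  simp [walk]

theorem pathBasis_append (K : Set (Fin X.r → ℝ)) (α : Basis (Fin X.r) ℝ (Dual ℝ (Fin X.r → ℝ)))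
    (a : List (Fin X.r)) (i : Fin X.r) :
    X.pathBasis K α (a ++ [i]) = (X.pathBasis K α a).map (basisReflection (X.pathBasis K α a) i
      (X.coeff (X.walk K α a).1 (X.pathBasis K α a) i)) := by
  simp only [pathBasis, walk_append, step]
  exact Basis.eq_of_apply_eq fun j => by simp only [Basis.map_apply, LinearEquiv.trans_apply]

theorem pathBasis_append_apply (K : Set (Fin X.r → ℝ))
    (α : Basis (Fin X.r) ℝ (Dual ℝ (Fin X.r → ℝ))) (a : List (Fin X.r)) (i j : Fin X.r) :
    X.pathBasis K α (a ++ [i]) j =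
      X.pathBasis K α a j - X.pathMatrix K α a i j • X.pathBasis K α a i := by
  rw [pathBasis_append, Basis.map_apply, basisReflection_apply, pathMatrix]
  split_ifs with hj
  · rw [hj]
    module
  · rw [neg_smul, sub_neg_eq_add, natCast_zsmul]

section

variable {K : Set (Fin X.r → ℝ)} {α : Basis (Fin X.r) ℝ (Dual ℝ (Fin X.r → ℝ))}

theorem isRootBasis_pathBasis (hK : K ∈ chambers X.𝒜) (hα : X.IsOrdering K α)
    (a : List (Fin X.r)) :
    IsRootBasis X.R (X.pathBasis K α a) ∧ (X.walk K α a).1 = posCone (X.pathBasis K α a) := by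
  induction a using List.reverseRecOn with
  | nil => exact isRootBasis_of_isOrdering hK hα
  | append_singleton a i ih =>
    obtain ⟨hb, hw⟩ := ih
    have hb' := isRootBasis_coeff hb i
    rw [pathBasis_append, hw]
    refine ⟨hb', ?_⟩
    rw [← nextChamber_posCone hb hb' (isStep_basisReflection _ i _), walk_append, ← hw,
      step, pathBasis, Basis.map_apply]

/-- The basis attached to an object of the scheme. -/
def objectBasis (K : Set (Fin X.r → ℝ)) (α : Basis (Fin X.r) ℝ (Dual ℝ (Fin X.r → ℝ)))
    (q : (X.cartanScheme K α).A) :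
    Basis (X.cartanScheme K α).I ℝ (Dual ℝ (Fin X.r → ℝ)) :=
  X.pathBasis K α (Quotient.out (s := X.pathSetoid K α) q)

theorem objectBasis_mk (a : List (Fin X.r)) :
    objectBasis K α (Quotient.mk (X.pathSetoid K α) a) = X.pathBasis K α a := by
  have : (X.walk K α (Quotient.mk (X.pathSetoid K α) a).out).2 = (X.walk K α a).2 :=
    Quotient.mk_out (s := X.pathSetoid K α) a
  change X.pathBasis K α _ = _
  rw [pathBasis, pathBasis, this]

theorem objectBasis_injective : Function.Injective (objectBasis K α) := by
  intro q q' h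
  rw [← Quotient.out_eq (s := X.pathSetoid K α) q, ← Quotient.out_eq (s := X.pathSetoid K α) q']
  refine Quotient.sound (LinearEquiv.toLinearMap_injective (α.ext fun j => ?_))
  exact congrArg (fun b : Basis (Fin X.r) ℝ (Dual ℝ (Fin X.r → ℝ)) => b j) h

theorem realizes_cartanScheme (hK : K ∈ chambers X.𝒜) (hα : X.IsOrdering K α) :
    (X.cartanScheme K α).Realizes X.R (objectBasis K α) where
  reduced := X.isReducedSet
  rootBasis _ := (isRootBasis_pathBasis hK hα _).1
  diag _ _ := if_pos rfl
  step q i j :=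
    (congrArg (fun b : Basis (Fin X.r) ℝ (Dual ℝ (Fin X.r → ℝ)) => b j)
      (objectBasis_mk (Quotient.out (s := X.pathSetoid K α) q ++ ([i] : List (Fin X.r))))).trans
      (pathBasis_append_apply K α _ i j)

instance : Nonempty (X.cartanScheme K α).A := ⟨Quotient.mk (X.pathSetoid K α) []⟩

instance : Nonempty (X.cartanScheme K α).I := ⟨(⟨0, X.r_pos⟩ : Fin X.r)⟩

theorem isConnected_cartanScheme (hK : K ∈ chambers X.𝒜) (hα : X.IsOrdering K α) :
    (X.cartanScheme K α).IsConnected := by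
  have h := realizes_cartanScheme hK hα
  refine CartanQuadruple.isConnected_of_reach
    (fun i a => objectBasis_injective (h.map_ρ_ρ a i)) (Quotient.mk (X.pathSetoid K α) []) ?_
  have key : ∀ a : List (Fin X.r), ∃ w, (X.cartanScheme K α).IsMorphism
      (Quotient.mk (X.pathSetoid K α) []) (Quotient.mk (X.pathSetoid K α) a) w := by
    intro a
    induction a using List.reverseRecOn with
    | nil => exact ⟨_, .id⟩
    | append_singleton a i ih =>
      obtain ⟨w, hw⟩ := ih
      -- The map `ρ i` extends a chosen representative instead of `a`; both extensions are steps
      -- from the same basis, so uniqueness of steps identifies their classes.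
      have hρ : (X.cartanScheme K α).ρ i (Quotient.mk (X.pathSetoid K α) a) =
          Quotient.mk (X.pathSetoid K α) (a ++ [i]) := by
        refine objectBasis_injective ((h.isStep _ i).unique (h.rootBasis _) (h.rootBasis _) ?_)
        rw [objectBasis_mk, objectBasis_mk, pathBasis_append]
        exact isStep_basisReflection _ i _
      have := CartanQuadruple.IsMorphism.comp _ _ i hw
      rw [hρ] at this
      exact ⟨_, this⟩
  intro q
  obtain ⟨a, rfl⟩ := Quotient.exists_rep (s := X.pathSetoid K α) q
  exact key a

theorem isFiniteType_cartanScheme (hK : K ∈ chambers X.𝒜) (hα : X.IsOrdering K α) :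
    (X.cartanScheme K α).IsFiniteType :=
  (realizes_cartanScheme hK hα).isFiniteType (isConnected_cartanScheme hK hα)
    objectBasis_injective

end

/-- The schemes of equivalent arrangements are equivalent. -/
theorem cartanScheme_equivalent {X Y : CrystallographicArrangement} (h : X.Equivalent Y)
    {K : Set (Fin X.r → ℝ)} {α : Basis (Fin X.r) ℝ (Dual ℝ (Fin X.r → ℝ))}
    (hK : K ∈ chambers X.𝒜) (hα : X.IsOrdering K α)
    {K' : Set (Fin Y.r → ℝ)} {α' : Basis (Fin Y.r) ℝ (Dual ℝ (Fin Y.r → ℝ))}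
    (hK' : K' ∈ chambers Y.𝒜) (hα' : Y.IsOrdering K' α') :
    (X.cartanScheme K α).Equivalent (Y.cartanScheme K' α') := by
  obtain ⟨ψ, hψ⟩ := h
  exact (realizes_cartanScheme hK hα).equivalent (isConnected_cartanScheme hK hα)
    objectBasis_injective (realizes_cartanScheme hK' hα') (isConnected_cartanScheme hK' hα')
    objectBasis_injective ψ hψ

theorem equivalent_of_cartanScheme {X Y : CrystallographicArrangement}
    {K : Set (Fin X.r → ℝ)} {α : Basis (Fin X.r) ℝ (Dual ℝ (Fin X.r → ℝ))}
    (hK : K ∈ chambers X.𝒜) (hα : X.IsOrdering K α)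
    {K' : Set (Fin Y.r → ℝ)} {α' : Basis (Fin Y.r) ℝ (Dual ℝ (Fin Y.r → ℝ))}
    (hK' : K' ∈ chambers Y.𝒜) (hα' : Y.IsOrdering K' α')
    (h : (X.cartanScheme K α).Equivalent (Y.cartanScheme K' α')) : X.Equivalent Y :=
  (realizes_cartanScheme hK hα).exists_linearEquiv (isConnected_cartanScheme hK hα)
    (realizes_cartanScheme hK' hα') (isConnected_cartanScheme hK' hα') h

theorem exists_isOrdering {K : Set (Fin X.r → ℝ)} (hK : K ∈ chambers X.𝒜) :
    ∃ α, X.IsOrdering K α := by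
  obtain ⟨b, hb, rfl⟩ := exists_rootBasis hK
  exact ⟨b, (base_posCone hb).symm⟩

/-! ### From schemes of finite type back to arrangements -/

/-- The arrangement of the kernels of the real roots of a realized scheme. -/
def ofRealizes {S : CartanQuadruple.{u, v}} {r : ℕ} (hr : 0 < r)
    {R : Set (Dual ℝ (Fin r → ℝ))} {β : S.A → Basis S.I ℝ (Dual ℝ (Fin r → ℝ))}
    (h : S.Realizes R β) (hA : Nonempty S.A) : CrystallographicArrangement :=
  have h0 : (0 : Dual ℝ (Fin r → ℝ)) ∉ R := fun h' => h.reduced.ne_zero h' rfl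
  -- Evaluation at a point of `K` is nonzero on all roots, so it is positive on the basis of some
  -- object; that cone is a chamber sharing this point with `K`.
  have hch : ∀ K ∈ chambers (hyperplanes R), ∃ a, K = posCone (β a) := by
    intro K hK
    obtain ⟨v, hv⟩ := nonempty_of_mem_chambers hK
    obtain ⟨a, ha⟩ := h.exists_pos (Dual.eval ℝ (Fin r → ℝ) v)
      (mem_complement_iff.1 (subset_complement hK hv))
    exact ⟨a, chambers_eq_of_mem hK (Arrangement.posCone_mem_chambers h0 (h.rootBasis a).mem
      (h.rootBasis a).pos_or_neg) hv ha⟩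
  { r := r
    r_pos := hr
    𝒜 := hyperplanes R
    R := R
    simplicial :=
      { finite := (h.reduced.finite.image LinearMap.ker).subset
          (by rintro _ ⟨x, hx, rfl⟩; exact ⟨x, hx, rfl⟩)
        hyperplane := by
          rintro _ ⟨x, hx, rfl⟩
          exact finrank_ker_add_one (h.reduced.ne_zero hx)
        cone := by
          intro K hK
          obtain ⟨a, rfl⟩ := hch K hK
          exact isOpenSimplicialCone_posCone (β a) }
    finite_R := h.reduced.finite
    𝒜_eq := rfl
    reduced := by
      intro x hx
      ext y
      constructor
      · rintro ⟨hy, t, rfl⟩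
        rcases h.reduced.reduced x hx t hy with rfl | rfl
        · exact Or.inl (one_smul ℝ x)
        · exact Or.inr (neg_one_smul ℝ x)
      · rintro (rfl | rfl)
        · exact ⟨hx, 1, (one_smul ℝ _).symm⟩
        · exact ⟨h.reduced.neg_mem x hx, -1, (neg_one_smul ℝ _).symm⟩
    integral := by
      intro K hK x hx
      obtain ⟨a, rfl⟩ := hch K hK
      rw [Arrangement.base_posCone h.reduced (h.rootBasis a).mem (h.rootBasis a).pos_or_neg]
      refine ((β a).mem_span_iff_repr_mem ℤ x).2 fun i => ?_
      obtain ⟨n, hn⟩ := (h.rootBasis a).integral x hx i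
      exact ⟨n, hn.symm⟩ }

/-- Every scheme of finite type is equivalent to the scheme of an arrangement. -/
theorem exists_cartanScheme_equivalent {S : CartanQuadruple.{u, v}} (hS : S.IsFiniteType) :
    ∃ X : CrystallographicArrangement, ∃ K ∈ chambers X.𝒜,
      ∃ α, X.IsOrdering K α ∧ (X.cartanScheme K α).Equivalent S := by
  have hI := hS.scheme.nonempty_I
  have hA := hS.scheme.nonempty_A
  -- Any basis labelled by `S.I` would do; it only fixes the coordinates in which the real roots at
  -- one object are placed.
  let γ : Basis S.I ℝ (Dual ℝ (Fin (Fintype.card S.I) → ℝ)) :=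
    (Pi.basisFun ℝ (Fin (Fintype.card S.I))).dualBasis.reindex (Fintype.equivFin S.I).symm
  obtain ⟨R, β, h⟩ := hS.exists_realizes γ
  let X := ofRealizes Fintype.card_pos h hA
  obtain ⟨K, hK⟩ := X.nonempty_chambers
  obtain ⟨α, hα⟩ := exists_isOrdering hK
  exact ⟨X, K, hK, α, hα, (realizes_cartanScheme hK hα).equivalent
    (isConnected_cartanScheme hK hα) objectBasis_injective h hS.connected (h.injective hS)
    (LinearEquiv.refl ℝ _) (Set.image_id _)⟩

end CrystallographicArrangement

end

/-! ### The correspondence -/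

theorem theorem4p4 :
    -- every arrangement has a chamber, and every chamber gives an (orderable) basis `B^K`
    (∀ X : CrystallographicArrangement,
      (Arrangement.chambers X.𝒜).Nonempty ∧
      ∀ K ∈ Arrangement.chambers X.𝒜, ∃ α, X.IsOrdering K α) ∧
    -- the map `Λ` is well defined and bijective
    (∃ Λ : Quotient CrystallographicArrangement.setoid →
        Quotient FiniteTypeScheme.setoid.{0, 0},
      (∀ X : CrystallographicArrangement, ∀ K ∈ Arrangement.chambers X.𝒜,
        ∀ α, X.IsOrdering K α →
          ∃ h : (X.cartanScheme K α).IsFiniteType,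
            Λ (Quotient.mk _ X) = Quotient.mk _ ⟨X.cartanScheme K α, h⟩) ∧
      Function.Bijective Λ) ∧
    -- `R` is the set of real roots: at each object, in the coordinates of the basis there
    (∀ X : CrystallographicArrangement, ∀ K ∈ Arrangement.chambers X.𝒜,
      ∀ α, X.IsOrdering K α → ∀ a : List (Fin X.r),
        X.R = (fun x : Fin X.r → ℤ => ∑ j, x j • X.pathBasis K α a j) ''
          (X.cartanScheme K α).realRoots (Quotient.mk (X.pathSetoid K α) a)) ∧
    -- surjectivity for Cartan schemes of arbitrary size
    (∀ S : CartanQuadruple.{u, v}, S.IsFiniteType →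
      ∃ X : CrystallographicArrangement, ∃ K ∈ Arrangement.chambers X.𝒜,
        ∃ α, X.IsOrdering K α ∧ (X.cartanScheme K α).Equivalent S) := by
  refine ⟨fun X => ⟨X.nonempty_chambers, fun K hK =>
    CrystallographicArrangement.exists_isOrdering hK⟩, ?_, ?_, fun S hS =>
    CrystallographicArrangement.exists_cartanScheme_equivalent hS⟩
  · choose K hK using fun X : CrystallographicArrangement => X.nonempty_chambers
    choose α hα using fun X => CrystallographicArrangement.exists_isOrdering (hK X)
    -- One chamber and one ordering are fixed per arrangement; independence of this choice is the
    -- equivalence of schemes applied to `X` and itself.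
    let F : CrystallographicArrangement → FiniteTypeScheme.{0, 0} := fun X =>
      ⟨X.cartanScheme (K X) (α X),
        CrystallographicArrangement.isFiniteType_cartanScheme (hK X) (hα X)⟩
    refine ⟨Quotient.lift (fun X => Quotient.mk _ (F X)) fun X Y hXY => Quotient.sound
      (CrystallographicArrangement.cartanScheme_equivalent hXY (hK X) (hα X) (hK Y) (hα Y)),
      fun X K' hK' α' hα' =>
        ⟨CrystallographicArrangement.isFiniteType_cartanScheme hK' hα', ?_⟩, ?_, ?_⟩
    · exact Quotient.sound (CrystallographicArrangement.cartanScheme_equivalent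
        (CrystallographicArrangement.setoid.refl X) (hK X) (hα X) hK' hα')
    · rintro ⟨X⟩ ⟨Y⟩ hXY
      exact Quotient.sound (CrystallographicArrangement.equivalent_of_cartanScheme (hK X) (hα X)
        (hK Y) (hα Y) (Quotient.exact hXY))
    · rintro ⟨S, hS⟩
      obtain ⟨X, K', hK', α', hα', hequiv⟩ :=
        CrystallographicArrangement.exists_cartanScheme_equivalent hS
      refine ⟨Quotient.mk _ X, Quotient.sound ?_⟩
      exact FiniteTypeScheme.setoid.trans
        (b := ⟨_, CrystallographicArrangement.isFiniteType_cartanScheme hK' hα'⟩)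
        (CrystallographicArrangement.cartanScheme_equivalent
          (CrystallographicArrangement.setoid.refl X) (hK X) (hα X) hK' hα') hequiv
  · intro X K hK α hα a
    have := (CrystallographicArrangement.realizes_cartanScheme hK hα).image_realRoots
      (CrystallographicArrangement.isConnected_cartanScheme hK hα)
      (Quotient.mk (X.pathSetoid K α) a)
    rw [CrystallographicArrangement.objectBasis_mk] at this
    exact this.symm
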